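/- Let $n\ge 1$ and $1<q\le p<\infty$. For $j\in\mathbb Z$ and $m\in\mathbb Z^n$ let $Q_{jm}=\prod_{\nu=1}^n[2^{-j}m_\nu,2^{-j}(m_\nu+1))$, let $\mathcal D_j=\{Q_{jm}:m\in\mathbb Z^n\}$ and $\mathcal D=\bigcup_{j\in\mathbb Z}\mathcal D_j$. For $a\in\mathbb Z/2\mathbb Z$ put $h^a(t)=\chi_{[0,1)}(2t)+(-1)^a\chi_{[1,2)}(2t)$; for $\varepsilon\in E=(\mathbb Z/2\mathbb Z)^n\setminus\{0\}$ put $h^\varepsilon(x)=\prod_{i=1}^n h^{\varepsilon_i}(x_i)$, and for $Q=Q_{jm}$ put $h^\varepsilon_Q(x)=2^{jn/2}h^\varepsilon(2^jx-m)$ and $\langle f,h^\varepsilon_Q\rangle=\int_{\mathbb R^n} f\,h^\varepsilon_Q\,dx$. Functions are scalar (real or complex) valued. Let $$\|F\|_{\mathcal M^p_q}=\sup_{Q\in\mathcal D}|Q|^{\frac1p-\frac1q}\Big(\int_Q|F(y)|^q\,dy\Big)^{\frac1q},$$ let $\mathcal M^p_q$ be the set of $f\in L^{q,\mathrm{loc}}(\mathbb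 R^n)$ with $\|f\|_{\mathcal M^p_q}<\infty$, and put $$S(f)=\sum_{\varepsilon\in E}\Big\|\Big(\sum_{j=-\infty}^\infty\Big|\sum_{Q\in\mathcal D_j}\langle f,h^\varepsilon_Q\rangle h^\varepsilon_Q\Big|^2\Big)^{1/2}\Big\|_{\mathcal M^p_q}\in[0,\infty].$$ There is a constant $C<\infty$, depending only on $n$, $p$ and $q$, such that the following hold. (i) If $f\in\mathcal M^p_q$, then $\|f\|_{\mathcal M^p_q}\le C\,S(f)$ and $S(f)\le C\,\|f\|_{\mathcal M^p_q}$. (ii) If $f$ is locally integrable and $S(f)<\infty$, then the limit $$g=\lim_{M\to\infty}\sum_{\varepsilon\in E}\sum_{j=-M}^{M}\sum_{Q\in\mathcal D_j}\langle f,h^\varepsilon_Q\rangle h^\varepsilon_Q$$ exists in the topology of $L^{q,\mathrm{loc}}(\mathbb R^n)$ (that is, in $L^q(K)$ for every compact $K$), $g\in\mathcal M^p_q$, and $\|g\|_{\mathcal M^p_q}\le C\,S(f)$ and $S(f)\le C\,\|g\|_{\mathcal M^p_q}$. -/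

import Mathlib

open MeasureTheory Filter Topology
open scoped NNReal ENNReal

noncomputable section

namespace HaarMorrey

/-- The index set `E = (ℤ/2ℤ)^n \ {0}`. -/
abbrev HaarIndex (n : ℕ) : Type := {ε : Fin n → ZMod 2 // ε ≠ 0}

/-- The dyadic cube `Q_{jm} = ∏_ν [m_ν / 2^j, (m_ν + 1) / 2^j)`.  Points of `ℝⁿ` are elements of
`Fin n → ℝ`; only Lebesgue measure and the topology are used, never the norm. -/
def dyadicCube {n : ℕ} (j : ℤ) (m : Fin n → ℤ) : Set (Fin n → ℝ) :=
  {x | ∀ i, x i ∈ Set.Ico ((m i : ℝ) / 2 ^ j) (((m i : ℝ) + 1) / 2 ^ j)}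

/-- The function `t ↦ χ_{[0,1)}(2t) + (-1)^a χ_{[1,2)}(2t)` on the line. -/
def haarLine (a : ZMod 2) (t : ℝ) : ℝ :=
  (Set.Ico (0 : ℝ) 1).indicator 1 (2 * t) + (-1) ^ a.val * (Set.Ico (1 : ℝ) 2).indicator 1 (2 * t)

/-- The tensor product `h^ε = h^{ε_1} ⊗ ⋯ ⊗ h^{ε_n}`. -/
def haarMother {n : ℕ} (ε : Fin n → ZMod 2) (x : Fin n → ℝ) : ℝ :=
  ∏ i, haarLine (ε i) (x i)

/-- The Haar function `h^ε_Q(x) = 2^{jn/2} h^ε(2^j x - m)` of the dyadic cube `Q = Q_{jm}`. -/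
def haar {n : ℕ} (ε : Fin n → ZMod 2) (j : ℤ) (m : Fin n → ℤ) (x : Fin n → ℝ) : ℝ :=
  (2 : ℝ) ^ ((j : ℝ) * n / 2) * haarMother ε (fun i => 2 ^ j * x i - m i)

variable {𝕜 : Type*} [RCLike 𝕜] {n : ℕ}

/-- The Haar coefficient `⟨f, h^ε_Q⟩ = ∫ f h^ε_Q`, where `Q = Q_{jm}`. -/
def haarCoeff (f : (Fin n → ℝ) → 𝕜) (ε : Fin n → ZMod 2) (j : ℤ) (m : Fin n → ℤ) : 𝕜 :=
  ∫ y, f y * (haar ε j m y : 𝕜)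

/-- The function `∑_{Q ∈ D_j} ⟨f, h^ε_Q⟩ h^ε_Q`.  At each point at most one term of the sum is
nonzero, since the cubes of one generation are disjoint. -/
def haarBlock (f : (Fin n → ℝ) → 𝕜) (ε : Fin n → ZMod 2) (j : ℤ) (x : Fin n → ℝ) : 𝕜 :=
  ∑' m : Fin n → ℤ, haarCoeff f ε j m * (haar ε j m x : 𝕜)

/-- The square function `(∑_{j ∈ ℤ} |∑_{Q ∈ D_j} ⟨f, h^ε_Q⟩ h^ε_Q|²)^{1/2}`, with values in
`[0, ∞]`. -/
def squareFunction (f : (Fin n → ℝ) → 𝕜) (ε : Fin n → ZMod 2) (x : Fin n → ℝ) : ℝ≥0∞ :=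
  (∑' j : ℤ, ‖haarBlock f ε j x‖ₑ ^ 2) ^ (1 / 2 : ℝ)

/-- The symmetric partial sum `∑_{ε ∈ E} ∑_{j=-M}^{M} ∑_{Q ∈ D_j} ⟨f, h^ε_Q⟩ h^ε_Q`. -/
def haarPartialSum (f : (Fin n → ℝ) → 𝕜) (M : ℕ) (x : Fin n → ℝ) : 𝕜 :=
  ∑ ε : HaarIndex n, ∑ j ∈ Finset.Icc (-(M : ℤ)) (M : ℤ), haarBlock f ε.1 j x

/-- The Morrey norm
`‖F‖_{M^p_q} = sup_{Q dyadic} |Q|^{1/p - 1/q} (∫_Q |F|^q)^{1/q}`, with values in `[0, ∞]`,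
for scalar functions as well as for functions with values in `[0, ∞]`. -/
def morreyNorm {α : Type*} [ENorm α]
    (p q : ℝ) (F : (Fin n → ℝ) → α) : ℝ≥0∞ :=
  ⨆ (j : ℤ) (m : Fin n → ℤ),
    volume (dyadicCube j m) ^ (1 / p - 1 / q) *
      (∫⁻ y in dyadicCube j m, ‖F y‖ₑ ^ q) ^ (1 / q)

/-- `f ∈ L^{q,loc}`: `f` is in `L^q` on every compact set. -/
def MemLqLoc (q : ℝ) (f : (Fin n → ℝ) → 𝕜) : Prop :=
  ∀ K : Set (Fin n → ℝ), IsCompact K → MemLp f (ENNReal.ofReal q) (volume.restrict K)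

/-- `f ∈ M^p_q`: `f ∈ L^{q,loc}` and its Morrey norm is finite. -/
def MemMorrey (p q : ℝ) (f : (Fin n → ℝ) → 𝕜) : Prop :=
  MemLqLoc q f ∧ morreyNorm p q f < ∞

/-- `F M → g` as `M → ∞` in the topology of `L^{q,loc}`, that is, in `L^q` on every compact set. -/
def TendstoLqLoc (q : ℝ) (F : ℕ → (Fin n → ℝ) → 𝕜) (g : (Fin n → ℝ) → 𝕜) : Prop :=
  (∀ M, MemLqLoc q (F M)) ∧ MemLqLoc q g ∧
    ∀ K : Set (Fin n → ℝ), IsCompact K →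
      Tendsto (fun M => eLpNorm (F M - g) (ENNReal.ofReal q) (volume.restrict K)) atTop (𝓝 0)

/-- The sum over `ε ∈ E` of the Morrey norms of the Haar square functions of `f`. -/
def squareMorreyNorm (p q : ℝ) (f : (Fin n → ℝ) → 𝕜) : ℝ≥0∞ :=
  ∑ ε : HaarIndex n, morreyNorm p q (squareFunction f ε.1)

end HaarMorrey

end

/-! Write E_j f for `dyadicAverage f j`. Summing the Haar blocks of generation j over ε ≠ 0 gives
E_{j+1} f - E_j f, so Haar sums telescope. Inside a dyadic cube of generation k, the layers of
generation at least k are the differences of a martingale. The modulus of each block of generation j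
is constant on the cubes of that generation. Hence `layerNorm f j` is predictable, dominates the
layer up to a constant, and its square is the conditional expectation of the squared modulus of the
layer.

For such martingales, the L^q norms of the martingale and of the square function are compared on
finite sets with counting measure. Upper bound (`exists_martingaleLeSquare`): for q ≤ 2, a transform
by a negative power of the predictable square sum reduces to L²; the passage from q to 2q squares
the martingale. The converse (`exists_square_le_martingale`) pairs the martingale with a transform
of itself, estimated in the conjugate exponent. Sampling at corners of small cubes transfers this to
finite Haar sums; Fatou's lemma and Lebesgue differentiation give `exists_square_estimates` on each
cube.

For the Morrey norm on a cube Q of generation k, these estimates handle generations at least k. In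
each lower generation j a block is bounded pointwise by 2^{jn/p} times the Morrey norm of f, or of
its square functions. This decays geometrically as j → -∞ because n > 0 and p < ∞. The same decay
makes E_{-l} f converge to a function c that is constant on every dyadic cube, hence on each
orthant. Haar functions do not see c, and g = f - c is the required function
(`exists_morreyNorm_sub_le`, `exists_squareMorreyNorm_le`). If f is itself in the Morrey space, its
averages over growing cubes tend to 0, so c = 0. -/

noncomputable section

namespace HaarMorrey

/-! ### Elementary inequalities for powers. -/

section RealInequalities

theorem one_sub_rpow_le {r u : ℝ} (hr : 0 < r) (hu : 0 ≤ u) (hu1 : u ≤ 1) :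
    1 - u ^ r ≤ (1 + r) * (1 - u) := by
  rcases le_total 1 r with h | h
  · have := one_add_mul_self_le_rpow_one_add (s := u - 1) (by linarith) h
    rw [add_sub_cancel] at this
    nlinarith
  · have := Real.rpow_le_rpow_of_exponent_ge' hu hu1 hr.le h
    rw [Real.rpow_one] at this
    nlinarith

theorem one_sub_le_rpow {r u : ℝ} (hr : 0 < r) (hu : 0 ≤ u) (hu1 : u ≤ 1) :
    1 - u ≤ (1 + 1 / r) * (1 - u ^ r) := by
  have h0 : u ^ r ≤ 1 := Real.rpow_le_one hu hu1 hr.le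
  have hr' : 0 < 1 / r := by positivity
  rcases le_total 1 r with h | h
  · have := Real.rpow_le_rpow_of_exponent_ge' hu hu1 zero_le_one h
    rw [Real.rpow_one] at this
    nlinarith
  · have := rpow_one_add_le_one_add_mul_self (s := u - 1) (by linarith) hr.le h
    rw [add_sub_cancel] at this
    have h1 : r * (1 - u) ≤ 1 - u ^ r := by linarith
    have h2 : 1 - u ≤ (1 / r) * (1 - u ^ r) := by
      rw [one_div, inv_mul_eq_div, le_div_iff₀ hr]; linarith
    linarith

/-- By homogeneity this is the case b = 1, where Bernoulli's inequality serves one range of r and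
monotonicity of the power in its exponent the other. Together with `rpow_mul_sub_le` it makes
b^(r-1)(b-a) and the telescoping b^r - a^r interchangeable, also for r < 1. -/
theorem rpow_sub_rpow_le {r a b : ℝ} (hr : 0 < r) (ha : 0 ≤ a) (hab : a ≤ b) :
    b ^ r - a ^ r ≤ (1 + r) * (b ^ (r - 1) * (b - a)) := by
  rcases (ha.trans hab).eq_or_lt with hb | hb
  · obtain rfl : a = 0 := by linarith
    simp [← hb]
  · have h := one_sub_rpow_le hr (div_nonneg ha hb.le) ((div_le_one hb).2 hab)
    have h2 := mul_le_mul_of_nonneg_left h (Real.rpow_nonneg hb.le r)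
    rw [Real.div_rpow ha hb.le] at h2
    have hbr : b ^ r = b ^ (r - 1) * b := by
      rw [← Real.rpow_add_one hb.ne']; ring_nf
    have hpos := Real.rpow_pos_of_pos hb r
    calc b ^ r - a ^ r = b ^ r * (1 - a ^ r / b ^ r) := by field_simp
      _ ≤ _ := h2
      _ = _ := by rw [hbr]; field_simp

theorem rpow_mul_sub_le {r a b : ℝ} (hr : 0 < r) (ha : 0 ≤ a) (hab : a ≤ b) :
    b ^ (r - 1) * (b - a) ≤ (1 + 1 / r) * (b ^ r - a ^ r) := by
  rcases (ha.trans hab).eq_or_lt with hb | hb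
  · obtain rfl : a = 0 := by linarith
    simp [← hb]
  · have h := one_sub_le_rpow hr (div_nonneg ha hb.le) ((div_le_one hb).2 hab)
    have h2 := mul_le_mul_of_nonneg_left h (Real.rpow_nonneg hb.le r)
    rw [Real.div_rpow ha hb.le] at h2
    have hbr : b ^ r = b ^ (r - 1) * b := by
      rw [← Real.rpow_add_one hb.ne']; ring_nf
    have hpos := Real.rpow_pos_of_pos hb r
    calc b ^ (r - 1) * (b - a) = b ^ r * (1 - a / b) := by rw [hbr]; field_simp
      _ ≤ _ := h2
      _ = _ := by field_simp

/-- Convexity estimate behind the maximal inequality. -/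
theorem rpow_sub_rpow_le_mul {r a b : ℝ} (hr : 1 < r) (ha : 0 ≤ a) (hab : a ≤ b) :
    b ^ r - a ^ r ≤ (1 + r) * (1 + 1 / (r - 1)) * (b * (b ^ (r - 1) - a ^ (r - 1))) := by
  rcases (ha.trans hab).eq_or_lt with hb | hb
  · obtain rfl : a = 0 := by linarith
    simp [← hb]
  · have h1 := rpow_sub_rpow_le (r := r) (by linarith) ha hab
    have h2 := rpow_mul_sub_le (r := r - 1) (by linarith) ha hab
    have h3 : b ^ (r - 1) = b * b ^ (r - 1 - 1) := by
      rw [mul_comm, ← Real.rpow_add_one hb.ne']; ring_nf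
    calc _ ≤ _ := h1
      _ = (1 + r) * (b * (b ^ (r - 1 - 1) * (b - a))) := by rw [h3]; ring
      _ ≤ (1 + r) * (b * ((1 + 1 / (r - 1)) * (b ^ (r - 1) - a ^ (r - 1)))) := by gcongr
      _ = _ := by ring

/-- Young's inequality for δ^(1/p) a and δ^(-1/p) b. The small coefficient lets the first term be
absorbed. -/
theorem exists_young_const {p q : ℝ} (h : p.HolderConjugate q) {δ : ℝ} (hδ : 0 < δ) :
    ∃ C : ℝ, 0 ≤ C ∧ ∀ a b : ℝ, 0 ≤ a → 0 ≤ b → a * b ≤ δ * a ^ p + C * b ^ q := by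
  set l := δ ^ (1 / p)
  have hl : 0 < l := Real.rpow_pos_of_pos hδ _
  have hlp : l ^ p = δ := by
    rw [← Real.rpow_mul hδ.le, one_div, inv_mul_cancel₀ h.ne_zero, Real.rpow_one]
  refine ⟨(l⁻¹) ^ q, by positivity, fun a b ha hb => ?_⟩
  have := Real.young_inequality_of_nonneg (a := l * a) (b := l⁻¹ * b) (by positivity)
    (by positivity) h
  rw [Real.mul_rpow hl.le ha, Real.mul_rpow (by positivity) hb, hlp] at this
  have e : l * a * (l⁻¹ * b) = a * b := by field_simp
  rw [e] at this
  refine this.trans (add_le_add ?_ ?_)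
  · exact div_le_self (by positivity) h.lt.le
  · exact div_le_self (by positivity) h.symm.lt.le

theorem add_rpow_le {q a b : ℝ} (hq : 0 ≤ q) (ha : 0 ≤ a) (hb : 0 ≤ b) :
    (a + b) ^ q ≤ 2 ^ q * (a ^ q + b ^ q) := by
  have : a + b ≤ 2 * max a b := by linarith [le_max_left a b, le_max_right a b]
  calc (a + b) ^ q ≤ (2 * max a b) ^ q := by gcongr
    _ = 2 ^ q * (max a b) ^ q := Real.mul_rpow zero_le_two (le_max_of_le_left ha)
    _ ≤ _ := by
      gcongr
      rcases max_choice a b with h | h <;> rw [h]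
      · linarith [Real.rpow_nonneg hb q]
      · linarith [Real.rpow_nonneg ha q]

theorem rpow_mul_rpow_le_add {s t a b : ℝ} (hs : 0 ≤ s) (ht : 0 ≤ t) (hst : 0 < s + t)
    (ha : 0 ≤ a) (hb : 0 ≤ b) :
    a ^ s * b ^ t ≤ a ^ (s + t) + b ^ (s + t) := by
  have hm : 0 ≤ max a b := le_max_of_le_left ha
  calc a ^ s * b ^ t ≤ (max a b) ^ s * (max a b) ^ t := by
        gcongr
        · exact le_max_left _ _
        · exact le_max_right _ _
    _ = (max a b) ^ (s + t) := (Real.rpow_add' hm hst.ne').symm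
    _ ≤ _ := by
      rcases max_choice a b with h | h <;> rw [h]
      · linarith [Real.rpow_nonneg hb (s + t)]
      · linarith [Real.rpow_nonneg ha (s + t)]

end RealInequalities

/-! ### Finite martingales and Doob's inequality. -/

section Martingale

variable {X ι : Type*} {𝕜 : Type*} [RCLike 𝕜]

open Function in
/-- `d 0, …, d (N - 1)` is a martingale difference sequence for the uniform measure on `Ω` and the
filtration generated by the increasingly fine partitions `π 0, π 1, …`. -/
structure IsMartingaleDifference (Ω : Finset X) (π : ℕ → X → ι) (N : ℕ) (d : ℕ → X → 𝕜) :
    Prop where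
  refines : ∀ ⦃j k⦄, j ≤ k → FactorsThrough (π j) (π k)
  adapted : ∀ k, FactorsThrough (d k) (π (k + 1))
  sum_eq_zero : ∀ k < N, ∀ w : X → 𝕜, FactorsThrough w (π k) → ∑ x ∈ Ω, w x * d k x = 0

/-- The martingale with difference sequence `d`, started at `0`. -/
def partialSum (d : ℕ → X → 𝕜) (k : ℕ) (x : X) : 𝕜 := ∑ j ∈ Finset.range k, d j x

/-- The running maximum `max_{j ≤ k} ‖f_j‖` of the martingale with differences `d`. -/
def runningMax (d : ℕ → X → 𝕜) : ℕ → X → ℝ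
  | 0, _ => 0
  | k + 1, x => max (runningMax d k x) ‖partialSum d (k + 1) x‖

/-- The sum `∑_{j < k} t_j²`. -/
def sumSq (t : ℕ → X → ℝ) (k : ℕ) (x : X) : ℝ := ∑ j ∈ Finset.range k, t j x ^ 2

variable {Ω : Finset X} {π : ℕ → X → ι} {N : ℕ} {d : ℕ → X → 𝕜} {t : ℕ → X → ℝ}

theorem partialSum_zero (x : X) : partialSum d 0 x = 0 := by simp [partialSum]

theorem partialSum_succ (k : ℕ) (x : X) : partialSum d (k + 1) x = partialSum d k x + d k x := by
  simp [partialSum, Finset.sum_range_succ]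

theorem sumSq_zero (x : X) : sumSq t 0 x = 0 := by simp [sumSq]

theorem sumSq_succ (k : ℕ) (x : X) : sumSq t (k + 1) x = sumSq t k x + t k x ^ 2 := by
  simp [sumSq, Finset.sum_range_succ]

theorem sumSq_nonneg (k : ℕ) (x : X) : 0 ≤ sumSq t k x := Finset.sum_nonneg fun _ _ => sq_nonneg _

theorem sumSq_mono (x : X) : Monotone fun k => sumSq t k x :=
  monotone_nat_of_le_succ fun k => by simp only [sumSq_succ]; linarith [sq_nonneg (t k x)]

theorem norm_partialSum_le_runningMax (k : ℕ) (x : X) :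
    ‖partialSum d k x‖ ≤ runningMax d k x := by
  cases k with
  | zero => simp [runningMax, partialSum_zero]
  | succ k => exact le_max_right _ _

theorem runningMax_mono (x : X) : Monotone fun k => runningMax d k x :=
  monotone_nat_of_le_succ fun _ => le_max_left _ _

theorem runningMax_nonneg (k : ℕ) (x : X) : 0 ≤ runningMax d k x :=
  (norm_nonneg (partialSum d k x)).trans (norm_partialSum_le_runningMax k x)

/-- Since t_k is known at time k, the sum through index k is already an admissible weight for d_k.
This shift by one is what permits the weights X_{k+1}^s below. -/
theorem factorsThrough_sumSq (hπ : ∀ ⦃j k⦄, j ≤ k → Function.FactorsThrough (π j) (π k))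
    (ht : ∀ k, Function.FactorsThrough (t k) (π k)) (k : ℕ) :
    Function.FactorsThrough (sumSq t (k + 1)) (π k) := fun x y h => by
  simp only [sumSq]
  exact Finset.sum_congr rfl fun j hj => by
    rw [ht j (hπ (Nat.lt_succ_iff.1 (Finset.mem_range.1 hj)) h)]

namespace IsMartingaleDifference

theorem factorsThrough_partialSum (hd : IsMartingaleDifference Ω π N d) (k : ℕ) :
    Function.FactorsThrough (partialSum d k) (π k) := fun x y h => by
  simp only [partialSum]
  exact Finset.sum_congr rfl fun j hj => hd.adapted j (hd.refines (Finset.mem_range.1 hj) h)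

theorem factorsThrough_runningMax (hd : IsMartingaleDifference Ω π N d) (k : ℕ) :
    Function.FactorsThrough (runningMax d k) (π k) := by
  induction k with
  | zero => intro x y _; rfl
  | succ k ih =>
    intro x y h
    simp only [runningMax]
    rw [ih (hd.refines k.le_succ h), hd.factorsThrough_partialSum (k + 1) h]

theorem mul (hd : IsMartingaleDifference Ω π N d) {w : ℕ → X → 𝕜}
    (hw : ∀ k, Function.FactorsThrough (w k) (π k)) :
    IsMartingaleDifference Ω π N fun k x => w k x * d k x where
  refines := hd.refines
  adapted k x y h := by
    simp only [hw k (hd.refines k.le_succ h), hd.adapted k h]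
  sum_eq_zero k hk v hv := by
    simp only [← mul_assoc]
    exact hd.sum_eq_zero k hk (fun x => v x * w k x) fun x y h => by simp only [hv h, hw k h]

theorem sum_mul_partialSum (hd : IsMartingaleDifference Ω π N d) {k : ℕ} {w : X → 𝕜}
    (hw : Function.FactorsThrough w (π k)) {l : ℕ} (hkl : k ≤ l) (hl : l ≤ N) :
    ∑ x ∈ Ω, w x * partialSum d l x = ∑ x ∈ Ω, w x * partialSum d k x := by
  induction l, hkl using Nat.le_induction with
  | base => rfl
  | succ l hkl ih =>
    rw [← ih (by omega)]
    simp only [partialSum_succ, mul_add, Finset.sum_add_distrib]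
    rw [hd.sum_eq_zero l (by omega) w fun x y h => hw (hd.refines hkl h), add_zero]

/-- The norm of a martingale is a submartingale. -/
theorem sum_mul_norm_le (hd : IsMartingaleDifference Ω π N d) {k : ℕ} (hk : k ≤ N) {w : X → ℝ}
    (hw : Function.FactorsThrough w (π k)) (hw0 : ∀ x, 0 ≤ w x) :
    ∑ x ∈ Ω, w x * ‖partialSum d k x‖ ≤ ∑ x ∈ Ω, w x * ‖partialSum d N x‖ := by
  set f := partialSum d k with hf
  have hfk := hd.factorsThrough_partialSum k
  -- The phase of f_k is known at time k, so pairing it with f_N is the same as pairing it with f_k.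
  -- Where f_k = 0 the inverse is 0 and both sides vanish.
  have h1 : ((∑ x ∈ Ω, w x * ‖f x‖ : ℝ) : 𝕜)
      = ∑ x ∈ Ω, ((w x : 𝕜) * (star (f x) * ((‖f x‖⁻¹ : ℝ) : 𝕜))) * partialSum d N x := by
    rw [hd.sum_mul_partialSum (k := k) (fun x y h => ?_) hk le_rfl, RCLike.ofReal_sum]
    · refine Finset.sum_congr rfl fun x _ => ?_
      have : star (f x) * f x = (‖f x‖ : 𝕜) ^ 2 := RCLike.conj_mul (f x)
      rw [← hf, mul_assoc, mul_right_comm, this, RCLike.ofReal_mul]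
      by_cases h0 : f x = 0
      · simp [h0]
      · have : (‖f x‖ : 𝕜) ≠ 0 := by simpa using h0
        rw [RCLike.ofReal_inv]
        field_simp
    · simp only [hw h, hf, hfk h]
  calc ∑ x ∈ Ω, w x * ‖f x‖ ≤ |∑ x ∈ Ω, w x * ‖f x‖| := le_abs_self _
    _ = ‖((∑ x ∈ Ω, w x * ‖f x‖ : ℝ) : 𝕜)‖ := (RCLike.norm_ofReal _).symm
    _ ≤ _ := by
      rw [h1]
      refine (norm_sum_le _ _).trans (Finset.sum_le_sum fun x _ => ?_)
      rw [norm_mul, norm_mul, norm_mul, norm_star, RCLike.norm_ofReal, RCLike.norm_ofReal,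
        abs_of_nonneg (hw0 x), abs_of_nonneg (by positivity)]
      refine mul_le_mul_of_nonneg_right ?_ (norm_nonneg _)
      exact mul_le_of_le_one_right (hw0 x) mul_inv_le_one

/-- Covariance of a martingale transform with the martingale. -/
theorem sum_star_mul_partialSum (hd : IsMartingaleDifference Ω π N d) {w : ℕ → X → ℝ}
    (hw : ∀ k, Function.FactorsThrough (w k) (π k)) {k : ℕ} (hk : k ≤ N) :
    ∑ x ∈ Ω, star (partialSum (fun k x => (w k x : 𝕜) * d k x) k x) * partialSum d k x
      = ((∑ j ∈ Finset.range k, ∑ x ∈ Ω, w j x * ‖d j x‖ ^ 2 : ℝ) : 𝕜) := by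
  induction k with
  | zero => simp [partialSum_zero]
  | succ k ih =>
    have he := hd.mul (w := fun k x => (w k x : 𝕜)) fun k x y h => by simp only [hw k h]
    have hek := he.factorsThrough_partialSum k
    have hdk := hd.factorsThrough_partialSum k
    set g := partialSum (fun k x => (w k x : 𝕜) * d k x) k with hg
    -- The two mixed terms of the product at time k + 1 vanish, because both partial sums at time k
    -- are known at time k.
    have h1 : ∑ x ∈ Ω, star (g x) * d k x = 0 :=
      hd.sum_eq_zero k hk (fun x => star (g x)) fun x y h => by simp only [hek h]
    have h2 : ∑ x ∈ Ω, star ((w k x : 𝕜) * d k x) * partialSum d k x = 0 := by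
      have := congrArg star (he.sum_eq_zero k hk (fun x => star (partialSum d k x))
        fun x y h => by simp only [hdk h])
      simp only [star_sum, star_mul', star_star, star_zero] at this
      rw [← this]
      exact Finset.sum_congr rfl fun x _ => by rw [star_mul', mul_comm]
    rw [Finset.sum_range_succ, RCLike.ofReal_add, ← ih (by omega)]
    simp only [partialSum_succ, star_add, add_mul, mul_add, Finset.sum_add_distrib]
    rw [← hg, h1, h2, add_zero, zero_add]
    congr 1
    rw [RCLike.ofReal_sum]
    refine Finset.sum_congr rfl fun x _ => ?_
    have : star (d k x) * d k x = (‖d k x‖ : 𝕜) ^ 2 := RCLike.conj_mul (d k x)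
    rw [star_mul', mul_assoc, this]
    simp [RCLike.star_def]

theorem sum_norm_sq (hd : IsMartingaleDifference Ω π N d) :
    ∑ x ∈ Ω, ‖partialSum d N x‖ ^ 2 = ∑ j ∈ Finset.range N, ∑ x ∈ Ω, ‖d j x‖ ^ 2 := by
  have h := hd.sum_star_mul_partialSum (w := fun _ _ => 1) (fun _ _ _ _ => rfl) le_rfl
  simp only [RCLike.ofReal_one, one_mul] at h
  have h2 : ∑ x ∈ Ω, star (partialSum d N x) * partialSum d N x
      = ((∑ x ∈ Ω, ‖partialSum d N x‖ ^ 2 : ℝ) : 𝕜) := by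
    rw [RCLike.ofReal_sum]
    refine Finset.sum_congr rfl fun x _ => ?_
    rw [RCLike.ofReal_pow]
    exact RCLike.conj_mul _
  exact RCLike.ofReal_injective (h2.symm.trans h)

end IsMartingaleDifference

/-- Doob's maximal inequality. -/
theorem exists_doob_const {r : ℝ} (hr : 1 < r) :
    ∃ C : ℝ, 0 ≤ C ∧ ∀ (Ω : Finset X) (π : ℕ → X → ι) (N : ℕ) (d : ℕ → X → 𝕜),
      IsMartingaleDifference Ω π N d →
      ∑ x ∈ Ω, runningMax d N x ^ r ≤ C * ∑ x ∈ Ω, ‖partialSum d N x‖ ^ r := by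
  set C₀ := (1 + r) * (1 + 1 / (r - 1))
  have hr1 : 0 < r - 1 := by linarith
  have hC₀ : 0 < C₀ := by positivity
  have hpq : (Real.conjExponent r).HolderConjugate r := (Real.HolderConjugate.conjExponent hr).symm
  -- With this coefficient, half of the sum of the maxima is absorbed at the end.
  obtain ⟨K, hK, hyoung⟩ := exists_young_const hpq (δ := 1 / (2 * C₀)) (by positivity)
  refine ⟨2 * C₀ * K, by positivity, fun Ω π N d hd => ?_⟩
  have key : ∀ k ≤ N, ∑ x ∈ Ω, runningMax d k x ^ r
      ≤ C₀ * ∑ x ∈ Ω, runningMax d k x ^ (r - 1) * ‖partialSum d N x‖ := by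
    intro k hk
    induction k with
    | zero => simp [runningMax, Real.zero_rpow hr1.ne', Real.zero_rpow (by linarith : r ≠ 0)]
    | succ k ih =>
      have h1 : ∀ x, runningMax d (k + 1) x ^ r - runningMax d k x ^ r
          ≤ C₀ * ((runningMax d (k + 1) x ^ (r - 1) - runningMax d k x ^ (r - 1))
            * ‖partialSum d (k + 1) x‖) := by
        intro x
        refine (rpow_sub_rpow_le_mul hr (runningMax_nonneg k x)
          (runningMax_mono x k.le_succ)).trans_eq ?_
        simp only [runningMax]
        -- Either the maximum does not move and both sides are 0, or its new value is the current
        -- norm.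
        rcases max_choice (runningMax d k x) ‖partialSum d (k + 1) x‖ with h | h
        · simp [h]
        · simp only [h]; ring
      -- The increments of the maximal function are nonnegative and known at time k + 1, so the
      -- submartingale property replaces the current norm by the final one.
      have h2 : ∑ x ∈ Ω, (runningMax d (k + 1) x ^ (r - 1) - runningMax d k x ^ (r - 1))
            * ‖partialSum d (k + 1) x‖ ≤
          ∑ x ∈ Ω, (runningMax d (k + 1) x ^ (r - 1) - runningMax d k x ^ (r - 1))
            * ‖partialSum d N x‖ := by
        refine hd.sum_mul_norm_le hk (fun x y h => ?_) fun x => ?_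
        · simp only [hd.factorsThrough_runningMax (k + 1) h,
            hd.factorsThrough_runningMax k (hd.refines k.le_succ h)]
        · exact sub_nonneg.2 (Real.rpow_le_rpow (runningMax_nonneg k x)
            (runningMax_mono x k.le_succ) hr1.le)
      have h3 := Finset.sum_le_sum fun x (_ : x ∈ Ω) => h1 x
      rw [← Finset.mul_sum, Finset.sum_sub_distrib] at h3
      have h4 := mul_le_mul_of_nonneg_left h2 hC₀.le
      simp only [sub_mul, Finset.sum_sub_distrib] at h4 h3
      have h5 := ih (by omega)
      linarith
  have h1 := key N le_rfl
  have h2 : ∀ x, runningMax d N x ^ (r - 1) * ‖partialSum d N x‖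
      ≤ 1 / (2 * C₀) * runningMax d N x ^ r + K * ‖partialSum d N x‖ ^ r := by
    intro x
    refine (hyoung _ _ (Real.rpow_nonneg (runningMax_nonneg N x) _) (norm_nonneg _)).trans_eq ?_
    rw [← Real.rpow_mul (runningMax_nonneg N x), Real.conjExponent, mul_div_cancel₀ _ hr1.ne']
  have h3 := mul_le_mul_of_nonneg_left (Finset.sum_le_sum fun x (_ : x ∈ Ω) => h2 x) hC₀.le
  rw [Finset.sum_add_distrib, ← Finset.mul_sum, ← Finset.mul_sum, mul_add] at h3
  have e : C₀ * (1 / (2 * C₀) * ∑ x ∈ Ω, runningMax d N x ^ r)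
      = (1 / 2) * ∑ x ∈ Ω, runningMax d N x ^ r := by field_simp
  rw [e] at h3
  nlinarith

end Martingale

/-! ### Square function inequalities for martingales with predictable majorants. -/

section Martingale

variable {X ι : Type*} {𝕜 : Type*} [RCLike 𝕜]

/-- Summation by parts for increasing weights. -/
theorem norm_sum_mul_le_of_monotone {a : ℕ → ℝ} (ha : Monotone a) (ha0 : ∀ k, 0 ≤ a k)
    {e : ℕ → 𝕜} {G : ℝ} {N : ℕ} (hG : ∀ k ≤ N + 1, ‖∑ j ∈ Finset.range k, e j‖ ≤ G) :
    ‖∑ k ∈ Finset.range (N + 1), (a k : 𝕜) * e k‖ ≤ 2 * a N * G := by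
  -- Passing from k to k + 1 changes the compared difference by (a_{k+1} - a_k) times a partial sum
  -- of norm at most G, and these increments telescope.
  have key : ∀ k ≤ N, ‖∑ j ∈ Finset.range k, (a j : 𝕜) * e j - a k * ∑ j ∈ Finset.range k, e j‖
      ≤ a k * G := by
    intro k hk
    have hG0 : 0 ≤ G := (norm_nonneg _).trans (hG 0 (by omega))
    induction k with
    | zero => simpa using mul_nonneg (ha0 0) hG0
    | succ k ih =>
      have h1 := ih (by omega)
      have h2 := hG (k + 1) (by omega)
      have e1 : ∑ j ∈ Finset.range (k + 1), (a j : 𝕜) * e j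
            - a (k + 1) * ∑ j ∈ Finset.range (k + 1), e j
          = (∑ j ∈ Finset.range k, (a j : 𝕜) * e j - a k * ∑ j ∈ Finset.range k, e j)
            - ((a (k + 1) - a k : ℝ) : 𝕜) * ∑ j ∈ Finset.range (k + 1), e j := by
        rw [Finset.sum_range_succ, Finset.sum_range_succ, RCLike.ofReal_sub]; ring
      rw [e1]
      refine (norm_sub_le _ _).trans ?_
      rw [norm_mul, RCLike.norm_ofReal, abs_of_nonneg (sub_nonneg.2 (ha k.le_succ))]
      have := mul_le_mul_of_nonneg_left h2 (sub_nonneg.2 (ha k.le_succ))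
      linarith
  have e1 : ∑ j ∈ Finset.range (N + 1), (a j : 𝕜) * e j
      = (∑ j ∈ Finset.range N, (a j : 𝕜) * e j - a N * ∑ j ∈ Finset.range N, e j)
        + (a N : 𝕜) * ∑ j ∈ Finset.range (N + 1), e j := by
    rw [Finset.sum_range_succ, Finset.sum_range_succ]; ring
  rw [e1]
  refine (norm_add_le _ _).trans ?_
  rw [norm_mul, RCLike.norm_ofReal, abs_of_nonneg (ha0 N)]
  have := mul_le_mul_of_nonneg_left (hG (N + 1) le_rfl) (ha0 N)
  linarith [key N le_rfl]

variable (X ι 𝕜) in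
/-- The `L^q` norm of a martingale whose differences are dominated by `c` times a predictable
sequence `t` is bounded by that of `(∑ t_k²)^{1/2}`, with constant `K`. -/
def MartingaleLeSquare (c q K : ℝ) : Prop :=
  ∀ (Ω : Finset X) (π : ℕ → X → ι) (N : ℕ) (d : ℕ → X → 𝕜) (t : ℕ → X → ℝ),
    IsMartingaleDifference Ω π N d → (∀ k, Function.FactorsThrough (t k) (π k)) →
    (∀ k x, ‖d k x‖ ≤ c * |t k x|) →
    ∑ x ∈ Ω, ‖partialSum d N x‖ ^ q ≤ K * ∑ x ∈ Ω, sumSq t N x ^ (q / 2)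

/-- With X_k = ∑_{j<k} t_j², the transform e_k = X_{k+1}^(-θ) d_k has squared L² norm controlled by
the integral of X_N^(q/2). Summation by parts bounds the original martingale by 2 X_N^θ times the
maximal function of the transform, and Doob's inequality in L² concludes. -/
theorem exists_martingaleLeSquare_of_le_two (c : ℝ) {q : ℝ} (hq : 1 < q) (hq2 : q ≤ 2) :
    ∃ K, 0 ≤ K ∧ MartingaleLeSquare X ι 𝕜 c q K := by
  obtain ⟨D, hD, doob⟩ := exists_doob_const (X := X) (ι := ι) (𝕜 := 𝕜) (r := 2) one_lt_two
  refine ⟨2 ^ q * (D * (c ^ 2 * (1 + 1 / (q / 2))) + 1), by positivity,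
    fun Ω π N d t hd ht hdt => ?_⟩
  cases N with
  | zero =>
    simp [partialSum_zero, sumSq_zero, Real.zero_rpow (by linarith : q ≠ 0),
      Real.zero_rpow (by linarith : q / 2 ≠ 0)]
  | succ N =>
  -- Here -2θ = q/2 - 1, so ‖e_k‖² is at most c² X_{k+1}^(q/2-1) (X_{k+1} - X_k), which is a
  -- constant times an increment of X^(q/2).
  set θ := (2 - q) / 4 with hθ
  have hθ0 : 0 ≤ θ := by rw [hθ]; linarith
  have hX := factorsThrough_sumSq hd.refines ht
  set e : ℕ → X → 𝕜 := fun k x => ((sumSq t (k + 1) x ^ (-θ) : ℝ) : 𝕜) * d k x with he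
  have hmd : IsMartingaleDifference Ω π (N + 1) e :=
    hd.mul fun k x y h => by simp only [hX k h]
  have hde : ∀ k x, d k x = ((sumSq t (k + 1) x ^ θ : ℝ) : 𝕜) * e k x := by
    intro k x
    -- Where X_{k+1} = 0, both t_k and d_k vanish, so dividing by the weight loses nothing.
    rcases (sumSq_nonneg (t := t) (k + 1) x).eq_or_lt with h0 | h0
    · have h1 : t k x = 0 := by
        have := sumSq_succ (t := t) k x
        have h2 := sumSq_nonneg (t := t) k x
        exact pow_eq_zero_iff two_ne_zero |>.1 (le_antisymm (by linarith) (sq_nonneg _))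
      have h2 : d k x = 0 := by simpa [h1] using hdt k x
      simp [he, h2]
    · simp only [he]
      rw [← mul_assoc, ← RCLike.ofReal_mul, ← Real.rpow_add h0]
      simp
  have hesq : ∀ k x, ‖e k x‖ ^ 2 ≤ c ^ 2 * (1 + 1 / (q / 2)) *
      (sumSq t (k + 1) x ^ (q / 2) - sumSq t k x ^ (q / 2)) := by
    intro k x
    have hx := sumSq_nonneg (t := t) (k + 1) x
    have h1 := rpow_mul_sub_le (r := q / 2) (by linarith) (sumSq_nonneg (t := t) k x)
      (sumSq_mono x k.le_succ)
    simp only [he, norm_mul, RCLike.norm_ofReal, mul_pow, sq_abs]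
    rw [← Real.rpow_natCast, ← Real.rpow_mul hx]
    have e1 : -θ * ((2 : ℕ) : ℝ) = q / 2 - 1 := by rw [hθ]; push_cast; ring
    rw [e1]
    have h2 : ‖d k x‖ ^ 2 ≤ c ^ 2 * (sumSq t (k + 1) x - sumSq t k x) := by
      rw [sumSq_succ, add_sub_cancel_left, ← sq_abs (t k x), ← mul_pow]
      exact pow_le_pow_left₀ (norm_nonneg _) (hdt k x) 2
    calc _ ≤ sumSq t (k + 1) x ^ (q / 2 - 1) * (c ^ 2 * (sumSq t (k + 1) x - sumSq t k x)) := by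
          gcongr
      _ = c ^ 2 * (sumSq t (k + 1) x ^ (q / 2 - 1) * (sumSq t (k + 1) x - sumSq t k x)) := by ring
      _ ≤ c ^ 2 * _ := mul_le_mul_of_nonneg_left h1 (sq_nonneg c)
      _ = _ := by ring
  have hgl2 : ∑ x ∈ Ω, ‖partialSum e (N + 1) x‖ ^ 2
      ≤ c ^ 2 * (1 + 1 / (q / 2)) * ∑ x ∈ Ω, sumSq t (N + 1) x ^ (q / 2) := by
    rw [hmd.sum_norm_sq]
    calc _ ≤ ∑ j ∈ Finset.range (N + 1), ∑ x ∈ Ω, c ^ 2 * (1 + 1 / (q / 2)) *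
        (sumSq t (j + 1) x ^ (q / 2) - sumSq t j x ^ (q / 2)) :=
          Finset.sum_le_sum fun j _ => Finset.sum_le_sum fun x _ => hesq j x
      _ = _ := by
        rw [Finset.sum_comm, Finset.mul_sum]
        refine Finset.sum_congr rfl fun x _ => ?_
        rw [← Finset.mul_sum, Finset.sum_range_sub fun j => sumSq t j x ^ (q / 2), sumSq_zero,
          Real.zero_rpow (by linarith : q / 2 ≠ 0), sub_zero]
  have hG := doob Ω π (N + 1) e hmd
  simp only [Real.rpow_two] at hG
  have hpt : ∀ x, ‖partialSum d (N + 1) x‖ ^ q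
      ≤ 2 ^ q * (runningMax e (N + 1) x ^ 2 + sumSq t (N + 1) x ^ (q / 2)) := by
    intro x
    have hx := sumSq_nonneg (t := t) (N + 1) x
    have h1 : ‖partialSum d (N + 1) x‖ ≤ 2 * sumSq t (N + 1) x ^ θ * runningMax e (N + 1) x := by
      simp only [partialSum, hde]
      refine norm_sum_mul_le_of_monotone (a := fun k => sumSq t (k + 1) x ^ θ) ?_ ?_ ?_
      · exact fun j k h => Real.rpow_le_rpow (sumSq_nonneg _ _)
          (sumSq_mono x (Nat.succ_le_succ h)) hθ0
      · exact fun k => Real.rpow_nonneg (sumSq_nonneg _ _) _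
      · exact fun k hk => (norm_partialSum_le_runningMax k x).trans (runningMax_mono x hk)
    have hM := runningMax_nonneg (d := e) (N + 1) x
    calc _ ≤ (2 * sumSq t (N + 1) x ^ θ * runningMax e (N + 1) x) ^ q := by gcongr
      _ = 2 ^ q * (runningMax e (N + 1) x ^ q * (sumSq t (N + 1) x ^ (q / 4)) ^ (2 - q)) := by
        rw [Real.mul_rpow (by positivity) hM, Real.mul_rpow zero_le_two (by positivity),
          ← Real.rpow_mul hx, ← Real.rpow_mul hx, hθ]
        ring_nf
      -- The powers q of the maximum and 2 - q of X^(q/4) add up to 2, which separates into the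
      -- squares of the two factors.
      _ ≤ 2 ^ q * _ := by
        refine mul_le_mul_of_nonneg_left ((rpow_mul_rpow_le_add (by linarith) (by linarith)
          (by linarith) hM (by positivity)).trans_eq ?_) (by positivity)
        rw [← Real.rpow_mul hx, add_sub_cancel, Real.rpow_two]
        ring_nf
  calc _ ≤ ∑ x ∈ Ω, 2 ^ q * (runningMax e (N + 1) x ^ 2 + sumSq t (N + 1) x ^ (q / 2)) :=
        Finset.sum_le_sum fun x _ => hpt x
    _ = 2 ^ q * (∑ x ∈ Ω, runningMax e (N + 1) x ^ 2 + ∑ x ∈ Ω, sumSq t (N + 1) x ^ (q / 2)) := by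
        rw [← Finset.mul_sum, Finset.sum_add_distrib]
    _ ≤ 2 ^ q * (D * (c ^ 2 * (1 + 1 / (q / 2)) * ∑ x ∈ Ω, sumSq t (N + 1) x ^ (q / 2))
          + ∑ x ∈ Ω, sumSq t (N + 1) x ^ (q / 2)) := by
        gcongr
        exact hG.trans (mul_le_mul_of_nonneg_left hgl2 hD)
    _ = _ := by ring

theorem partialSum_sq (d : ℕ → X → 𝕜) (N : ℕ) (x : X) :
    partialSum d N x ^ 2 = 2 * partialSum (fun k x => partialSum d k x * d k x) N x
      + ∑ k ∈ Finset.range N, d k x ^ 2 := by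
  induction N with
  | zero => simp [partialSum_zero]
  | succ N ih =>
    rw [partialSum_succ, partialSum_succ, Finset.sum_range_succ, add_sq, ih]; ring

/-- The square of the martingale is twice the transform ∑ f_k d_k plus ∑ d_k². The transform has the
predictable majorant ‖f_k‖ t_k, so the hypothesis at q applies to it; the resulting maximal function
is absorbed by Doob's inequality at 2q. -/
theorem MartingaleLeSquare.exists_two_mul {c q K : ℝ} (hq : 1 < q) (hK : 0 ≤ K)
    (h : MartingaleLeSquare X ι 𝕜 c q K) :
    ∃ K', 0 ≤ K' ∧ MartingaleLeSquare X ι 𝕜 c (2 * q) K' := by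
  obtain ⟨D, hD, doob⟩ := exists_doob_const (X := X) (ι := ι) (𝕜 := 𝕜) (r := 2 * q) (by linarith)
  set A := (2 : ℝ) ^ q * 2 ^ q * K with hA
  have hA0 : 0 ≤ A := by positivity
  -- After multiplication by A and by the Doob constant D the first term is at most half of the left
  -- side. The added ones avoid division by zero.
  obtain ⟨Y, hY, young⟩ := exists_young_const (p := 2) (q := 2)
    (by rw [Real.holderConjugate_iff]; norm_num) (δ := 1 / (2 * (A + 1) * (D + 1))) (by positivity)
  refine ⟨2 * (A * Y + 2 ^ q * (c ^ 2) ^ q), by positivity, fun Ω π N d t hd ht hdt => ?_⟩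
  set e : ℕ → X → 𝕜 := fun k x => partialSum d k x * d k x with he
  have hmd : IsMartingaleDifference Ω π N e := hd.mul hd.factorsThrough_partialSum
  have h1 := h Ω π N e (fun k x => ‖partialSum d k x‖ * t k x) hmd
    (fun k x y hxy => by simp only [hd.factorsThrough_partialSum k hxy, ht k hxy]) (fun k x => by
      simp only [he]
      rw [norm_mul, abs_mul, abs_norm, mul_left_comm]
      exact mul_le_mul_of_nonneg_left (hdt k x) (norm_nonneg _))
  have h2 : ∀ x, sumSq (fun k x => ‖partialSum d k x‖ * t k x) N x ^ (q / 2)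
      ≤ runningMax d N x ^ q * sumSq t N x ^ (q / 2) := by
    intro x
    have hM := runningMax_nonneg (d := d) N x
    have : sumSq (fun k x => ‖partialSum d k x‖ * t k x) N x
        ≤ runningMax d N x ^ 2 * sumSq t N x := by
      rw [sumSq, sumSq, Finset.mul_sum]
      refine Finset.sum_le_sum fun j hj => ?_
      rw [mul_pow]
      gcongr
      exact (norm_partialSum_le_runningMax j x).trans
        (runningMax_mono x (Finset.mem_range.1 hj).le)
    calc _ ≤ (runningMax d N x ^ 2 * sumSq t N x) ^ (q / 2) :=
          Real.rpow_le_rpow (sumSq_nonneg _ _) this (by linarith)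
      _ = _ := by
        rw [Real.mul_rpow (sq_nonneg _) (sumSq_nonneg _ _), ← Real.rpow_two, ← Real.rpow_mul hM]
        ring_nf
  have h3 : ∀ x, runningMax d N x ^ q * sumSq t N x ^ (q / 2)
      ≤ 1 / (2 * (A + 1) * (D + 1)) * runningMax d N x ^ (2 * q) + Y * sumSq t N x ^ q := by
    intro x
    have hM := runningMax_nonneg (d := d) N x
    have hx := sumSq_nonneg (t := t) N x
    refine (young _ _ (by positivity) (by positivity)).trans_eq ?_
    rw [← Real.rpow_mul hM, ← Real.rpow_mul hx]
    ring_nf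
  have h4 : ∀ x, ‖partialSum d N x‖ ^ (2 * q)
      ≤ 2 ^ q * 2 ^ q * ‖partialSum e N x‖ ^ q + 2 ^ q * (c ^ 2) ^ q * sumSq t N x ^ q := by
    intro x
    have hx := sumSq_nonneg (t := t) N x
    have e1 : ‖partialSum d N x‖ ^ 2 ≤ 2 * ‖partialSum e N x‖ + c ^ 2 * sumSq t N x := by
      rw [← norm_pow, partialSum_sq]
      refine (norm_add_le _ _).trans (add_le_add ?_ ?_)
      · rw [norm_mul, RCLike.norm_two]
      · rw [sumSq, Finset.mul_sum]
        refine (norm_sum_le _ _).trans (Finset.sum_le_sum fun k _ => ?_)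
        rw [norm_pow, ← sq_abs (t k x), ← mul_pow]
        exact pow_le_pow_left₀ (norm_nonneg _) (hdt k x) 2
    calc ‖partialSum d N x‖ ^ (2 * q) = (‖partialSum d N x‖ ^ 2) ^ q := by
          rw [Real.rpow_mul (norm_nonneg _), Real.rpow_two]
      _ ≤ (2 * ‖partialSum e N x‖ + c ^ 2 * sumSq t N x) ^ q := by gcongr
      _ ≤ 2 ^ q * ((2 * ‖partialSum e N x‖) ^ q + (c ^ 2 * sumSq t N x) ^ q) :=
        add_rpow_le (by linarith) (by positivity) (by positivity)
      _ = _ := by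
        rw [Real.mul_rpow zero_le_two (norm_nonneg _), Real.mul_rpow (sq_nonneg c) hx]; ring
  have hd2 := doob Ω π N d hd
  set SF := ∑ x ∈ Ω, ‖partialSum d N x‖ ^ (2 * q) with hSF
  have hSF0 : 0 ≤ SF := Finset.sum_nonneg fun _ _ => by positivity
  have e2 : (2 * q) / 2 = q := by ring
  rw [e2]
  set SX := ∑ x ∈ Ω, sumSq t N x ^ q with hSX
  set SM := ∑ x ∈ Ω, runningMax d N x ^ (2 * q) with hSM
  have h5 : SF ≤ 2 ^ q * 2 ^ q * ∑ x ∈ Ω, ‖partialSum e N x‖ ^ q + 2 ^ q * (c ^ 2) ^ q * SX := by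
    rw [hSX, Finset.mul_sum, Finset.mul_sum, ← Finset.sum_add_distrib]
    exact Finset.sum_le_sum fun x _ => h4 x
  have h6 : ∑ x ∈ Ω, sumSq (fun k x => ‖partialSum d k x‖ * t k x) N x ^ (q / 2)
      ≤ 1 / (2 * (A + 1) * (D + 1)) * SM + Y * SX := by
    rw [hSX, hSM, Finset.mul_sum, Finset.mul_sum, ← Finset.sum_add_distrib]
    exact Finset.sum_le_sum fun x _ => (h2 x).trans (h3 x)
  have h7 : SF ≤ A * (1 / (2 * (A + 1) * (D + 1)) * SM + Y * SX) + 2 ^ q * (c ^ 2) ^ q * SX := by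
    refine h5.trans (add_le_add_left ?_ _)
    calc _ ≤ 2 ^ q * 2 ^ q * (K * (1 / (2 * (A + 1) * (D + 1)) * SM + Y * SX)) := by
          refine mul_le_mul_of_nonneg_left (h1.trans ?_) (by positivity)
          exact mul_le_mul_of_nonneg_left h6 hK
      _ = _ := by rw [hA]; ring
  have h8 : A * (1 / (2 * (A + 1) * (D + 1)) * SM) ≤ 1 / 2 * SF := by
    calc _ ≤ A * (1 / (2 * (A + 1) * (D + 1)) * (D * SF)) := by gcongr
      _ = (A / (A + 1)) * (D / (D + 1)) * (1 / 2 * SF) := by field_simp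
      _ ≤ 1 * (1 / 2 * SF) := by
        gcongr
        refine mul_le_one₀ ?_ (by positivity) ?_ <;> rw [div_le_one (by positivity)] <;> linarith
      _ = _ := one_mul _
  linarith

theorem exists_martingaleLeSquare (c : ℝ) {q : ℝ} (hq : 1 < q) :
    ∃ K, 0 ≤ K ∧ MartingaleLeSquare X ι 𝕜 c q K := by
  have key : ∀ (m : ℕ) (q : ℝ), 1 < q → q ≤ 2 ^ m * 2 →
      ∃ K, 0 ≤ K ∧ MartingaleLeSquare X ι 𝕜 c q K := by
    intro m
    induction m with
    | zero => exact fun q hq hq2 => exists_martingaleLeSquare_of_le_two c hq (by simpa using hq2)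
    | succ m ih =>
      intro q hq hqm
      rcases le_or_gt q 2 with h | h
      · exact exists_martingaleLeSquare_of_le_two c hq h
      · obtain ⟨K, hK, hA⟩ := ih (q / 2) (by linarith) (by rw [pow_succ] at hqm; linarith)
        have := hA.exists_two_mul (by linarith) hK
        rwa [mul_div_cancel₀ _ two_ne_zero] at this
  obtain ⟨m, hm⟩ := pow_unbounded_of_one_lt q one_lt_two
  exact key m q hq (by linarith)

/-- The converse inequality when `t_k²` is the conditional expectation of `‖d_k‖²`. -/
theorem exists_square_le_martingale (c : ℝ) {q : ℝ} (hq : 1 < q) :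
    ∃ K, 0 ≤ K ∧ ∀ (Ω : Finset X) (π : ℕ → X → ι) (N : ℕ) (d : ℕ → X → 𝕜) (t : ℕ → X → ℝ),
      IsMartingaleDifference Ω π N d → (∀ k, Function.FactorsThrough (t k) (π k)) →
      (∀ k x, ‖d k x‖ ≤ c * |t k x|) →
      (∀ k < N, ∀ w : X → ℝ, Function.FactorsThrough w (π k) →
        ∑ x ∈ Ω, w x * ‖d k x‖ ^ 2 = ∑ x ∈ Ω, w x * t k x ^ 2) →
      ∑ x ∈ Ω, sumSq t N x ^ (q / 2) ≤ K * ∑ x ∈ Ω, ‖partialSum d N x‖ ^ q := by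
  have hpq : q.HolderConjugate (Real.conjExponent q) := Real.HolderConjugate.conjExponent hq
  set q' := Real.conjExponent q with hq'
  -- The direct estimate is used at the conjugate exponent, for the dual martingale g below.
  obtain ⟨K, hK, hA⟩ := exists_martingaleLeSquare (X := X) (ι := ι) (𝕜 := 𝕜) c hpq.symm.lt
  have hq1 : 0 < q - 1 := by linarith
  have hqq' : (q - 1) * q' = q := by rw [hq', Real.conjExponent, mul_div_cancel₀ _ hq1.ne']
  set B := K * (1 + 1 / (q - 1)) ^ (q' / 2) with hB
  have hB0 : 0 ≤ B := by positivity
  obtain ⟨Y, hY, young⟩ := exists_young_const hpq.symm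
    (δ := 1 / (2 * (1 + q / 2) * (B + 1))) (by positivity)
  refine ⟨2 * (1 + q / 2) * Y, by positivity, fun Ω π N d t hd ht hdt hsq => ?_⟩
  have hX := factorsThrough_sumSq hd.refines ht
  -- With this weight ∑ w_k t_k² is comparable to X_N^(q/2), while ∑ (w_k t_k)² is at most a
  -- constant times X_N^(q-1), whose power q'/2 is again X_N^(q/2).
  set w : ℕ → X → ℝ := fun k x => sumSq t (k + 1) x ^ (q / 2 - 1) with hw
  have hw0 : ∀ k x, 0 ≤ w k x := fun k x => Real.rpow_nonneg (sumSq_nonneg _ _) _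
  have hwf : ∀ k, Function.FactorsThrough (w k) (π k) := fun k x y h => by simp only [hw, hX k h]
  have hmd := hd.mul (w := fun k x => (w k x : 𝕜)) fun k x y h => by simp only [hwf k h]
  set g := partialSum (fun k x => (w k x : 𝕜) * d k x) N with hg
  have hcov := hd.sum_star_mul_partialSum hwf le_rfl
  have h1 : ∑ j ∈ Finset.range N, ∑ x ∈ Ω, w j x * t j x ^ 2
      ≤ ∑ x ∈ Ω, ‖g x‖ * ‖partialSum d N x‖ := by
    -- This uses the conditional expectation hypothesis: the covariance of g and the martingale
    -- involves ‖d_j‖², and the predictable weight permits replacing it by t_j².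
    have e1 : ∑ j ∈ Finset.range N, ∑ x ∈ Ω, w j x * ‖d j x‖ ^ 2
        = ∑ j ∈ Finset.range N, ∑ x ∈ Ω, w j x * t j x ^ 2 :=
      Finset.sum_congr rfl fun j hj => hsq j (Finset.mem_range.1 hj) _ (hwf j)
    rw [e1] at hcov
    calc _ ≤ |∑ j ∈ Finset.range N, ∑ x ∈ Ω, w j x * t j x ^ 2| := le_abs_self _
      _ = _ := (RCLike.norm_ofReal (K := 𝕜) _).symm
      _ ≤ _ := by
        rw [← hcov]
        refine (norm_sum_le _ _).trans_eq (Finset.sum_congr rfl fun x _ => ?_)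
        rw [norm_mul, norm_star]
  have h2 : ∑ x ∈ Ω, sumSq t N x ^ (q / 2)
      ≤ (1 + q / 2) * ∑ j ∈ Finset.range N, ∑ x ∈ Ω, w j x * t j x ^ 2 := by
    rw [Finset.sum_comm, Finset.mul_sum]
    refine Finset.sum_le_sum fun x _ => ?_
    have : sumSq t N x ^ (q / 2)
        = ∑ j ∈ Finset.range N, (sumSq t (j + 1) x ^ (q / 2) - sumSq t j x ^ (q / 2)) := by
      rw [Finset.sum_range_sub fun j => sumSq t j x ^ (q / 2), sumSq_zero,
          Real.zero_rpow (by linarith : q / 2 ≠ 0), sub_zero]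
    rw [this, Finset.mul_sum]
    refine Finset.sum_le_sum fun j _ => ?_
    refine (rpow_sub_rpow_le (by linarith) (sumSq_nonneg _ _)
      (sumSq_mono x j.le_succ)).trans_eq ?_
    simp only [hw]
    rw [sumSq_succ j x, add_sub_cancel_left]
  have h3 : ∀ x, sumSq (fun k x => w k x * t k x) N x ^ (q' / 2)
      ≤ (1 + 1 / (q - 1)) ^ (q' / 2) * sumSq t N x ^ (q / 2) := by
    intro x
    have hx := sumSq_nonneg (t := t) N x
    have : sumSq (fun k x => w k x * t k x) N x
        ≤ (1 + 1 / (q - 1)) * sumSq t N x ^ (q - 1) := by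
      have e1 : sumSq t N x ^ (q - 1)
          = ∑ j ∈ Finset.range N, (sumSq t (j + 1) x ^ (q - 1) - sumSq t j x ^ (q - 1)) := by
        rw [Finset.sum_range_sub fun j => sumSq t j x ^ (q - 1), sumSq_zero,
          Real.zero_rpow hq1.ne', sub_zero]
      rw [e1, Finset.mul_sum, sumSq]
      refine Finset.sum_le_sum fun j _ => ?_
      refine Eq.trans_le ?_ (rpow_mul_sub_le hq1 (sumSq_nonneg _ _) (sumSq_mono x j.le_succ))
      rw [mul_pow, sumSq_succ j x, add_sub_cancel_left, hw, ← sumSq_succ j x]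
      simp only
      rw [← Real.rpow_natCast, ← Real.rpow_mul (sumSq_nonneg _ _)]
      congr 2
      push_cast; ring
    calc _ ≤ ((1 + 1 / (q - 1)) * sumSq t N x ^ (q - 1)) ^ (q' / 2) :=
          Real.rpow_le_rpow (sumSq_nonneg _ _) this (by linarith [hpq.symm.pos])
      _ = _ := by
        rw [Real.mul_rpow (by positivity) (by positivity), ← Real.rpow_mul hx, ← mul_div_assoc,
          hqq']
  have h4 : ∑ x ∈ Ω, ‖g x‖ ^ q' ≤ B * ∑ x ∈ Ω, sumSq t N x ^ (q / 2) := by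
    refine (hA Ω π N _ (fun k x => w k x * t k x) hmd
      (fun k x y h => by simp only [hwf k h, ht k h]) fun k x => ?_).trans ?_
    · rw [norm_mul, RCLike.norm_ofReal, abs_mul, mul_left_comm]
      exact mul_le_mul_of_nonneg_left (hdt k x) (abs_nonneg _)
    · rw [hB, mul_assoc]
      refine mul_le_mul_of_nonneg_left ?_ hK
      rw [Finset.mul_sum]
      exact Finset.sum_le_sum fun x _ => h3 x
  have h5 : ∑ x ∈ Ω, ‖g x‖ * ‖partialSum d N x‖ ≤ 1 / (2 * (1 + q / 2) * (B + 1)) *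
      ∑ x ∈ Ω, ‖g x‖ ^ q' + Y * ∑ x ∈ Ω, ‖partialSum d N x‖ ^ q := by
    rw [Finset.mul_sum, Finset.mul_sum, ← Finset.sum_add_distrib]
    exact Finset.sum_le_sum fun x _ => young _ _ (norm_nonneg _) (norm_nonneg _)
  set SX := ∑ x ∈ Ω, sumSq t N x ^ (q / 2)
  have hSX0 : 0 ≤ SX := Finset.sum_nonneg fun x _ => Real.rpow_nonneg (sumSq_nonneg _ _) _
  set SF := ∑ x ∈ Ω, ‖partialSum d N x‖ ^ q
  have h6 : (1 + q / 2) * (1 / (2 * (1 + q / 2) * (B + 1)) * ∑ x ∈ Ω, ‖g x‖ ^ q')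
      ≤ 1 / 2 * SX := by
    calc _ ≤ (1 + q / 2) * (1 / (2 * (1 + q / 2) * (B + 1)) * (B * SX)) := by gcongr
      _ = B / (B + 1) * (1 / 2 * SX) := by field_simp
      _ ≤ 1 * (1 / 2 * SX) := by
        gcongr
        rw [div_le_one (by positivity)]; linarith
      _ = _ := one_mul _
  have h7 := h2.trans (mul_le_mul_of_nonneg_left (h1.trans h5) (by positivity))
  rw [mul_add] at h7
  linarith

end Martingale

/-! ### Dyadic cubes as a filtration, and integrals as sums over corners. -/

section Cubes

variable {n : ℕ}

/-- The index of the dyadic cube of generation `j` that contains `x`. -/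
def cubeIndex (j : ℤ) (x : Fin n → ℝ) : Fin n → ℤ := fun i => ⌊(2 : ℝ) ^ j * x i⌋

/-- The lower corner of a dyadic cube. -/
def corner (j : ℤ) (m : Fin n → ℤ) : Fin n → ℝ := fun i => (m i : ℝ) / 2 ^ j

variable (n) in
/-- The volume of the dyadic cubes of generation `j`. -/
def cubeVolume (j : ℤ) : ℝ := (((2 : ℝ) ^ j)⁻¹) ^ n

theorem cubeVolume_pos (j : ℤ) : 0 < cubeVolume n j := by
  unfold cubeVolume; positivity

theorem mem_dyadicCube {j : ℤ} {m : Fin n → ℤ} {x : Fin n → ℝ} :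
    x ∈ dyadicCube j m ↔ cubeIndex j x = m := by
  have h2 : (0 : ℝ) < 2 ^ j := by positivity
  simp only [dyadicCube, Set.mem_ofPred_eq, funext_iff, cubeIndex, Int.floor_eq_iff, Set.mem_Ico]
  refine forall_congr' fun i => ?_
  rw [div_le_iff₀ h2, lt_div_iff₀ h2, mul_comm]

theorem self_mem_dyadicCube (j : ℤ) (x : Fin n → ℝ) : x ∈ dyadicCube j (cubeIndex j x) :=
  mem_dyadicCube.2 rfl

theorem cubeIndex_corner (j : ℤ) (m : Fin n → ℤ) : cubeIndex j (corner j m) = m := by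
  have h2 : (2 : ℝ) ^ j ≠ 0 := by positivity
  funext i
  simp only [cubeIndex, corner]
  rw [mul_div_cancel₀ _ h2, Int.floor_intCast]

theorem corner_injective (j : ℤ) : Function.Injective (corner (n := n) j) := fun m m' h => by
  rw [← cubeIndex_corner j m, h, cubeIndex_corner]

/-- Nestedness of the dyadic grids: the coarse index is the integer part of the fine one divided by
a power of 2. -/
theorem cubeIndex_factorsThrough {j k : ℤ} (h : j ≤ k) :
    Function.FactorsThrough (cubeIndex (n := n) j) (cubeIndex k) := by
  intro x y hxy
  funext i
  have hi := congrFun hxy i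
  obtain ⟨l, rfl⟩ := Int.le.dest h
  have e : ∀ u : ℝ, (2 : ℝ) ^ j * u = (2 : ℝ) ^ (j + (l : ℤ)) * u / ((2 ^ l : ℕ) : ℝ) := by
    intro u
    rw [zpow_add₀ two_ne_zero, zpow_natCast]
    push_cast
    field_simp
  simp only [cubeIndex] at hi ⊢
  rw [e, e, Int.floor_div_natCast, Int.floor_div_natCast, hi]

theorem dyadicCube_eq_pi (j : ℤ) (m : Fin n → ℤ) :
    dyadicCube j m
      = Set.univ.pi fun i => Set.Ico ((m i : ℝ) / 2 ^ j) (((m i : ℝ) + 1) / 2 ^ j) := by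
  ext x; simp [dyadicCube]

theorem measurableSet_dyadicCube (j : ℤ) (m : Fin n → ℤ) : MeasurableSet (dyadicCube j m) := by
  rw [dyadicCube_eq_pi]
  exact MeasurableSet.univ_pi fun _ => measurableSet_Ico

theorem volume_dyadicCube (j : ℤ) (m : Fin n → ℤ) :
    volume (dyadicCube j m) = ENNReal.ofReal (cubeVolume n j) := by
  rw [dyadicCube_eq_pi, Real.volume_pi_Ico, cubeVolume, ENNReal.ofReal_pow (by positivity)]
  have : ∀ i, ((m i : ℝ) + 1) / 2 ^ j - (m i : ℝ) / 2 ^ j = ((2 : ℝ) ^ j)⁻¹ := fun i => by ring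
  simp [this]

theorem volume_real_dyadicCube (j : ℤ) (m : Fin n → ℤ) :
    volume.real (dyadicCube j m) = cubeVolume n j := by
  rw [Measure.real, volume_dyadicCube, ENNReal.toReal_ofReal (cubeVolume_pos j).le]

theorem finite_cubeIndex_image (j : ℤ) (m : Fin n → ℤ) (k : ℤ) :
    (cubeIndex k '' dyadicCube j m).Finite := by
  refine (Set.finite_Icc (fun i => ⌊(2 : ℝ) ^ k * ((m i : ℝ) / 2 ^ j)⌋)
    (fun i => ⌊(2 : ℝ) ^ k * (((m i : ℝ) + 1) / 2 ^ j)⌋)).subset ?_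
  rintro _ ⟨y, hy, rfl⟩
  exact ⟨fun i => Int.floor_le_floor (mul_le_mul_of_nonneg_left (hy i).1 (by positivity)),
    fun i => Int.floor_le_floor (mul_le_mul_of_nonneg_left (hy i).2.le (by positivity))⟩

/-- The indices of the dyadic cubes of generation `k` that meet the cube `Q_{jm}`. -/
def subcubes (j : ℤ) (m : Fin n → ℤ) (k : ℤ) : Finset (Fin n → ℤ) :=
  (finite_cubeIndex_image j m k).toFinset

theorem mem_subcubes {j : ℤ} {m : Fin n → ℤ} {k : ℤ} {m' : Fin n → ℤ} :
    m' ∈ subcubes j m k ↔ ∃ y ∈ dyadicCube j m, cubeIndex k y = m' := by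
  simp [subcubes]

theorem iUnion_subcubes {j k : ℤ} (h : j ≤ k) (m : Fin n → ℤ) :
    ⋃ m' ∈ subcubes j m k, dyadicCube k m' = dyadicCube j m := by
  ext x
  simp only [Set.mem_iUnion, mem_subcubes, exists_prop]
  constructor
  · rintro ⟨_, ⟨y, hy, rfl⟩, hx⟩
    rw [mem_dyadicCube] at *
    rw [cubeIndex_factorsThrough h hx, hy]
  · exact fun hx => ⟨_, ⟨x, hx, rfl⟩, self_mem_dyadicCube k x⟩

theorem pairwise_disjoint_dyadicCube (k : ℤ) :
    Pairwise (Function.onFun Disjoint (dyadicCube (n := n) k)) := fun _ _ h =>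
  Set.disjoint_left.2 fun _ hx hx' => h ((mem_dyadicCube.1 hx).symm.trans (mem_dyadicCube.1 hx'))

theorem lintegral_eq_sum_subcubes {j k : ℤ} (h : j ≤ k) (m : Fin n → ℤ) (F : (Fin n → ℝ) → ℝ≥0∞) :
    ∫⁻ x in dyadicCube j m, F x = ∑ m' ∈ subcubes j m k, ∫⁻ x in dyadicCube k m', F x := by
  rw [← iUnion_subcubes h, lintegral_biUnion_finset ((pairwise_disjoint_dyadicCube k).set_pairwise _)
    fun _ _ => measurableSet_dyadicCube _ _]

theorem measurable_of_factorsThrough {α : Type*} [MeasurableSpace α] {F : (Fin n → ℝ) → α} {k : ℤ}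
    (hF : Function.FactorsThrough F (cubeIndex k)) : Measurable F := by
  have : F = (fun m => F (corner k m)) ∘ cubeIndex k := by
    funext x
    exact hF (cubeIndex_corner k _).symm
  rw [this]
  refine (measurable_of_countable _).comp (measurable_pi_lambda _ fun i => ?_)
  exact ((measurable_pi_apply i).const_mul _).floor

theorem eqOn_of_factorsThrough {α : Type*} {F : (Fin n → ℝ) → α} {k : ℤ}
    (hF : Function.FactorsThrough F (cubeIndex k)) (m : Fin n → ℤ) :
    Set.EqOn F (fun _ => F (corner k m)) (dyadicCube k m) := fun _ hx =>
  hF ((mem_dyadicCube.1 hx).trans (cubeIndex_corner k m).symm)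

theorem lintegral_of_factorsThrough {F : (Fin n → ℝ) → ℝ≥0∞} {k : ℤ}
    (hF : Function.FactorsThrough F (cubeIndex k)) (m : Fin n → ℤ) :
    ∫⁻ x in dyadicCube k m, F x = F (corner k m) * ENNReal.ofReal (cubeVolume n k) := by
  rw [setLIntegral_congr_fun (measurableSet_dyadicCube k m) (eqOn_of_factorsThrough hF m),
    setLIntegral_const, volume_dyadicCube]

/-- The corners of the cubes of generation `k` in `Q_{jm}`. -/
def sampling (j : ℤ) (m : Fin n → ℤ) (k : ℤ) : Finset (Fin n → ℝ) :=
  (subcubes j m k).map ⟨corner k, corner_injective k⟩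

theorem lintegral_eq_sum_sampling {j k : ℤ} (h : j ≤ k) (m : Fin n → ℤ) {F : (Fin n → ℝ) → ℝ≥0∞}
    (hF : Function.FactorsThrough F (cubeIndex k)) :
    ∫⁻ x in dyadicCube j m, F x
      = (∑ x ∈ sampling j m k, F x) * ENNReal.ofReal (cubeVolume n k) := by
  simp [lintegral_eq_sum_subcubes h, sampling, lintegral_of_factorsThrough hF, Finset.sum_mul]

variable {E : Type*} [NormedAddCommGroup E]

theorem integrableOn_dyadicCube_of_factorsThrough {F : (Fin n → ℝ) → E} {k : ℤ}
    (hF : Function.FactorsThrough F (cubeIndex k)) (m : Fin n → ℤ) :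
    IntegrableOn F (dyadicCube k m) := by
  refine (integrableOn_const (C := F (corner k m)) ?_).congr_fun
    (eqOn_of_factorsThrough hF m).symm (measurableSet_dyadicCube k m)
  rw [volume_dyadicCube]; exact ENNReal.ofReal_ne_top

variable [NormedSpace ℝ E]

theorem integral_eq_sum_subcubes {j k : ℤ} (h : j ≤ k) (m : Fin n → ℤ) {F : (Fin n → ℝ) → E}
    (hF : ∀ m', IntegrableOn F (dyadicCube k m')) :
    ∫ x in dyadicCube j m, F x = ∑ m' ∈ subcubes j m k, ∫ x in dyadicCube k m', F x := by
  rw [← iUnion_subcubes h, integral_biUnion_finset _ (fun _ _ => measurableSet_dyadicCube _ _)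
    ((pairwise_disjoint_dyadicCube k).set_pairwise _) fun m' _ => hF m']

theorem integral_eq_sum_sampling [CompleteSpace E] {j k : ℤ} (h : j ≤ k) (m : Fin n → ℤ)
    {F : (Fin n → ℝ) → E} (hF : Function.FactorsThrough F (cubeIndex k)) :
    ∫ x in dyadicCube j m, F x = cubeVolume n k • ∑ x ∈ sampling j m k, F x := by
  rw [integral_eq_sum_subcubes h m (integrableOn_dyadicCube_of_factorsThrough hF),
    Finset.smul_sum, sampling, Finset.sum_map]
  refine Finset.sum_congr rfl fun m' _ => ?_
  rw [setIntegral_congr_fun (measurableSet_dyadicCube k m') (eqOn_of_factorsThrough hF m'),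
    setIntegral_const, volume_real_dyadicCube]
  rfl

end Cubes

/-! ### Signs of Haar functions: multiplicativity, completeness and mean zero. -/

section Sign

variable {n : ℕ}

theorem neg_one_pow_val_add (a b : ZMod 2) :
    (-1 : ℝ) ^ (a + b).val = (-1) ^ a.val * (-1) ^ b.val := by
  have h : ∀ a b : ZMod 2, (-1 : ℤ) ^ (a + b).val = (-1) ^ a.val * (-1) ^ b.val := by decide
  exact_mod_cast congrArg (Int.cast : ℤ → ℝ) (h a b)

theorem haarLine_of_notMem {a : ZMod 2} {u : ℝ} (h : u ∉ Set.Ico (0 : ℝ) 1) : haarLine a u = 0 := by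
  have h1 : 2 * u ∉ Set.Ico (0 : ℝ) 1 := fun h' => h ⟨by linarith [h'.1], by linarith [h'.2, h'.1]⟩
  have h2 : 2 * u ∉ Set.Ico (1 : ℝ) 2 := fun h' => h ⟨by linarith [h'.1], by linarith [h'.2]⟩
  simp [haarLine, h1, h2]

theorem haarLine_fract (a : ZMod 2) (v : ℝ) :
    haarLine a (Int.fract v) = if ⌊2 * v⌋ = 2 * ⌊v⌋ then 1 else (-1) ^ a.val := by
  have h0 := Int.fract_nonneg v
  have h1 := Int.fract_lt_one v
  have hv := Int.floor_add_fract v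
  have key : ⌊2 * v⌋ = 2 * ⌊v⌋ ↔ 2 * Int.fract v < 1 := by
    rw [Int.floor_eq_iff]
    push_cast
    constructor
    · intro h; linarith [h.2]
    · intro h; constructor <;> linarith
  by_cases h : 2 * Int.fract v < 1
  · have e1 : 2 * Int.fract v ∈ Set.Ico (0 : ℝ) 1 := ⟨by linarith, h⟩
    have e2 : 2 * Int.fract v ∉ Set.Ico (1 : ℝ) 2 := fun h' => by linarith [h'.1]
    rw [if_pos (key.2 h), haarLine, Set.indicator_of_mem e1, Set.indicator_of_notMem e2]
    simp
  · have e1 : 2 * Int.fract v ∉ Set.Ico (0 : ℝ) 1 := fun h' => h h'.2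
    have e2 : 2 * Int.fract v ∈ Set.Ico (1 : ℝ) 2 := ⟨by linarith, by linarith⟩
    rw [if_neg fun h' => h (key.1 h'), haarLine, Set.indicator_of_mem e2,
      Set.indicator_of_notMem e1]
    simp

/-- The sign of the Haar function `h^ε_Q` at `x`, where `Q` is the cube of generation `j`
containing `x`. -/
def haarSign (ε : Fin n → ZMod 2) (j : ℤ) (x : Fin n → ℝ) : ℝ :=
  ∏ i, if cubeIndex (j + 1) x i = 2 * cubeIndex j x i then 1 else (-1) ^ (ε i).val

theorem haarSign_factorsThrough (ε : Fin n → ZMod 2) (j : ℤ) :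
    Function.FactorsThrough (haarSign ε j) (cubeIndex (j + 1)) := fun x y h => by
  simp only [haarSign, h, cubeIndex_factorsThrough (show j ≤ j + 1 by omega) h]

theorem haarMother_fract (ε : Fin n → ZMod 2) (j : ℤ) (x : Fin n → ℝ) :
    haarMother ε (fun i => Int.fract ((2 : ℝ) ^ j * x i)) = haarSign ε j x := by
  simp only [haarMother, haarSign, haarLine_fract, cubeIndex, zpow_add_one₀ (two_ne_zero (α := ℝ))]
  simp only [mul_comm _ (2 : ℝ), mul_assoc]

theorem haar_eq (ε : Fin n → ZMod 2) (j : ℤ) (m : Fin n → ℤ) (x : Fin n → ℝ) :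
    haar ε j m x = if cubeIndex j x = m then (2 : ℝ) ^ ((j : ℝ) * n / 2) * haarSign ε j x else 0 := by
  split_ifs with h
  · rw [haar, ← haarMother_fract, ← h]
    rfl
  · obtain ⟨i, hi⟩ := Function.ne_iff.1 h
    have : (2 : ℝ) ^ j * x i - m i ∉ Set.Ico (0 : ℝ) 1 := by
      intro h'
      exact hi (Int.floor_eq_iff.2 ⟨by linarith [h'.1], by linarith [h'.2]⟩)
    rw [haar, haarMother, Finset.prod_eq_zero (Finset.mem_univ i) (haarLine_of_notMem this),
      mul_zero]

theorem haarSign_zero (j : ℤ) (x : Fin n → ℝ) : haarSign 0 j x = 1 := by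
  simp [haarSign]

/-- At a fixed point the signs form a character of (ℤ/2ℤ)^n in ε. Orthogonality of different blocks
thus reduces to the vanishing mean of a single sign. -/
theorem haarSign_mul (ε ε' : Fin n → ZMod 2) (j : ℤ) (x : Fin n → ℝ) :
    haarSign ε j x * haarSign ε' j x = haarSign (ε + ε') j x := by
  rw [haarSign, haarSign, haarSign, ← Finset.prod_mul_distrib]
  refine Finset.prod_congr rfl fun i _ => ?_
  split_ifs
  · simp
  · rw [Pi.add_apply, neg_one_pow_val_add]

theorem haarSign_mul_self (ε : Fin n → ZMod 2) (j : ℤ) (x : Fin n → ℝ) :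
    haarSign ε j x * haarSign ε j x = 1 := by
  rw [haarSign_mul, show ε + ε = 0 from funext fun i => CharTwo.add_self_eq_zero (ε i),
    haarSign_zero]

theorem abs_haarSign (ε : Fin n → ZMod 2) (j : ℤ) (x : Fin n → ℝ) : |haarSign ε j x| = 1 := by
  have := haarSign_mul_self ε j x
  rw [← abs_mul_abs_self] at this
  nlinarith [abs_nonneg (haarSign ε j x)]

theorem cubeIndex_succ_eq_or (j : ℤ) (x : Fin n → ℝ) (i : Fin n) :
    cubeIndex (j + 1) x i = 2 * cubeIndex j x i ∨
      cubeIndex (j + 1) x i = 2 * cubeIndex j x i + 1 := by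
  simp only [cubeIndex, zpow_add_one₀ (two_ne_zero (α := ℝ))]
  set v := (2 : ℝ) ^ j * x i with hv
  have e : (2 : ℝ) ^ j * 2 * x i = 2 * v := by rw [hv]; ring
  rw [e]
  have h1 := Int.floor_le v
  have h2 := Int.lt_floor_add_one v
  have h3 : 2 * ⌊v⌋ ≤ ⌊2 * v⌋ := Int.le_floor.2 (by push_cast; linarith)
  have h4 : ⌊2 * v⌋ < 2 * ⌊v⌋ + 2 := Int.floor_lt.2 (by push_cast; linarith)
  omega

/-- Completeness of the Haar signs of one generation. -/
theorem sum_haarSign_mul (j : ℤ) {x y : Fin n → ℝ} (h : cubeIndex j x = cubeIndex j y) :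
    ∑ ε : Fin n → ZMod 2, haarSign ε j x * haarSign ε j y
      = if cubeIndex (j + 1) x = cubeIndex (j + 1) y then 2 ^ n else 0 := by
  have key : ∀ i, (∑ a : ZMod 2,
      (if cubeIndex (j + 1) x i = 2 * cubeIndex j x i then (1 : ℝ) else (-1) ^ a.val) *
      (if cubeIndex (j + 1) y i = 2 * cubeIndex j y i then (1 : ℝ) else (-1) ^ a.val))
      = if cubeIndex (j + 1) x i = cubeIndex (j + 1) y i then 2 else 0 := by
    intro i
    have hu : (Finset.univ : Finset (ZMod 2)) = {0, 1} := by decide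
    have h1 : (1 : ZMod 2).val = 1 := by decide
    have hi := congrFun h i
    rw [hu, Finset.sum_pair (by decide), h1, ZMod.val_zero]
    rcases cubeIndex_succ_eq_or j x i with hx | hx <;>
    rcases cubeIndex_succ_eq_or j y i with hy | hy <;>
    simp only [hx, hy, hi] <;> norm_num
  simp only [haarSign, ← Finset.prod_mul_distrib]
  rw [← Fintype.piFinset_univ, ← Finset.prod_univ_sum (fun _ => Finset.univ) (fun i (a : ZMod 2) =>
      (if cubeIndex (j + 1) x i = 2 * cubeIndex j x i then (1 : ℝ) else (-1) ^ a.val) *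
      (if cubeIndex (j + 1) y i = 2 * cubeIndex j y i then (1 : ℝ) else (-1) ^ a.val)),
    Finset.prod_congr rfl fun i _ => key i]
  split_ifs with h'
  · simp [h']
  · obtain ⟨i, hi⟩ := Function.ne_iff.1 h'
    exact Finset.prod_eq_zero (Finset.mem_univ i) (by simp [hi])

theorem integral_haarLine_one : ∫ t, haarLine 1 t = 0 := by
  set g : ℝ → ℝ := (Set.Ico (0 : ℝ) (1 / 2)).indicator 1 with hg
  have hgi : Integrable g := (integrable_indicator_iff measurableSet_Ico).2
    (integrableOn_const (by simp))
  have e : haarLine 1 = fun t => g t - g (t - 1 / 2) := by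
    funext t
    have h1 : (1 : ZMod 2).val = 1 := by decide
    have e1 : (Set.Ico (0 : ℝ) 1).indicator 1 (2 * t) = g t := by
      simp only [hg, Set.indicator_apply, Set.mem_Ico]
      exact if_congr ⟨fun h => ⟨by linarith [h.1], by linarith [h.2]⟩,
        fun h => ⟨by linarith [h.1], by linarith [h.2]⟩⟩ rfl rfl
    have e2 : (Set.Ico (1 : ℝ) 2).indicator 1 (2 * t) = g (t - 1 / 2) := by
      simp only [hg, Set.indicator_apply, Set.mem_Ico]
      exact if_congr ⟨fun h => ⟨by linarith [h.1], by linarith [h.2]⟩,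
        fun h => ⟨by linarith [h.1], by linarith [h.2]⟩⟩ rfl rfl
    rw [haarLine, e1, e2, h1]; ring
  rw [e, integral_sub hgi (hgi.comp_sub_right _), integral_sub_right_eq_self, sub_self]

/-- By Fubini the integral is a product, and a coordinate with ε_i = 1 contributes the factor 0. -/
theorem integral_haar {ε : Fin n → ZMod 2} (hε : ε ≠ 0) (j : ℤ) (m : Fin n → ℤ) :
    ∫ x, haar ε j m x = 0 := by
  obtain ⟨i, hi⟩ := Function.ne_iff.1 hε
  have hi1 : ε i = 1 := by
    have : ∀ a : ZMod 2, a ≠ 0 → a = 1 := by decide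
    exact this _ hi
  simp only [haar, haarMother]
  rw [integral_const_mul, integral_fintype_prod_volume_eq_prod
    (fun i (t : ℝ) => haarLine (ε i) (2 ^ j * t - m i)),
    Finset.prod_eq_zero (Finset.mem_univ i), mul_zero]
  rw [Measure.integral_comp_mul_left (fun t => haarLine (ε i) (t - m i)),
    integral_sub_right_eq_self, hi1, integral_haarLine_one, smul_zero]

theorem integral_haarSign {ε : Fin n → ZMod 2} (hε : ε ≠ 0) (j : ℤ) (m : Fin n → ℤ) :
    ∫ x in dyadicCube j m, haarSign ε j x = 0 := by
  have h := integral_haar hε j m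
  have e : haar ε j m = (dyadicCube j m).indicator
      fun x => (2 : ℝ) ^ ((j : ℝ) * n / 2) * haarSign ε j x := by
    funext x
    by_cases h : cubeIndex j x = m <;> simp [haar_eq, Set.indicator, mem_dyadicCube, h]
  rw [e, integral_indicator (measurableSet_dyadicCube j m), integral_const_mul] at h
  exact (mul_eq_zero.1 h).resolve_left (by positivity)

end Sign

variable {𝕜 : Type*} [RCLike 𝕜] {n : ℕ}

/-! ### Haar blocks, dyadic averages and telescoping. -/

section Blocks

/-- The mean of `f` over the dyadic cube of generation `j` containing `x`. -/
def dyadicAverage (f : (Fin n → ℝ) → 𝕜) (j : ℤ) (x : Fin n → ℝ) : 𝕜 :=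
  ((cubeVolume n j)⁻¹ : ℝ) * ∫ y in dyadicCube j (cubeIndex j x), f y

theorem dyadicAverage_factorsThrough (f : (Fin n → ℝ) → 𝕜) (j : ℤ) :
    Function.FactorsThrough (dyadicAverage f j) (cubeIndex j) := fun x y h => by
  simp only [dyadicAverage, h]

theorem two_rpow_mul_self (n : ℕ) (j : ℤ) :
    (2 : ℝ) ^ ((j : ℝ) * n / 2) * (2 : ℝ) ^ ((j : ℝ) * n / 2) = (cubeVolume n j)⁻¹ := by
  rw [← Real.rpow_add two_pos, cubeVolume, inv_pow, inv_inv, add_halves, Real.rpow_mul zero_le_two,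
    Real.rpow_intCast, Real.rpow_natCast]

theorem haarCoeff_eq (f : (Fin n → ℝ) → 𝕜) (ε : Fin n → ZMod 2) (j : ℤ) (m : Fin n → ℤ) :
    haarCoeff f ε j m = ((2 : ℝ) ^ ((j : ℝ) * n / 2) : ℝ) *
      ∫ y in dyadicCube j m, f y * (haarSign ε j y : 𝕜) := by
  have e : (fun y => f y * (haar ε j m y : 𝕜)) = (dyadicCube j m).indicator
      fun y => (((2 : ℝ) ^ ((j : ℝ) * n / 2) : ℝ) : 𝕜) * (f y * (haarSign ε j y : 𝕜)) := by
    funext x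
    by_cases h : cubeIndex j x = m
    · simp only [haar_eq, Set.indicator, mem_dyadicCube, h, if_true, RCLike.ofReal_mul]; ring
    · simp [haar_eq, Set.indicator, mem_dyadicCube, h]
  rw [haarCoeff, e, integral_indicator (measurableSet_dyadicCube j m), integral_const_mul]

theorem haarBlock_eq (f : (Fin n → ℝ) → 𝕜) (ε : Fin n → ZMod 2) (j : ℤ) (x : Fin n → ℝ) :
    haarBlock f ε j x
      = dyadicAverage (fun y => f y * (haarSign ε j y : 𝕜)) j x * (haarSign ε j x : 𝕜) := by
  rw [haarBlock, tsum_eq_single (cubeIndex j x), haarCoeff_eq, haar_eq, if_pos rfl, dyadicAverage,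
    ← two_rpow_mul_self, RCLike.ofReal_mul, RCLike.ofReal_mul]
  · ring
  · intro m hm
    rw [haar_eq, if_neg hm.symm, RCLike.ofReal_zero, mul_zero]

theorem haarBlock_factorsThrough (f : (Fin n → ℝ) → 𝕜) (ε : Fin n → ZMod 2) (j : ℤ) :
    Function.FactorsThrough (haarBlock f ε j) (cubeIndex (j + 1)) := fun x y h => by
  rw [haarBlock_eq, haarBlock_eq, haarSign_factorsThrough ε j h,
    dyadicAverage_factorsThrough _ j (cubeIndex_factorsThrough (show j ≤ j + 1 by omega) h)]

theorem norm_haarBlock (f : (Fin n → ℝ) → 𝕜) (ε : Fin n → ZMod 2) (j : ℤ) (x : Fin n → ℝ) :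
    ‖haarBlock f ε j x‖ = ‖dyadicAverage (fun y => f y * (haarSign ε j y : 𝕜)) j x‖ := by
  rw [haarBlock_eq, norm_mul, RCLike.norm_ofReal, abs_haarSign, mul_one]

/-- Only the sign of a block varies within a cube of its own generation. This is the predictability
on which the martingale estimates rest. -/
theorem norm_haarBlock_factorsThrough (f : (Fin n → ℝ) → 𝕜) (ε : Fin n → ZMod 2) (j : ℤ) :
    Function.FactorsThrough (fun x => ‖haarBlock f ε j x‖) (cubeIndex j) := fun x y h => by
  simp only [norm_haarBlock, dyadicAverage_factorsThrough _ j h]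

theorem measurable_haarSign (ε : Fin n → ZMod 2) (j : ℤ) : Measurable (haarSign ε j) :=
  measurable_of_factorsThrough (haarSign_factorsThrough ε j)

theorem isBounded_dyadicCube (j : ℤ) (m : Fin n → ℤ) : Bornology.IsBounded (dyadicCube j m) := by
  rw [dyadicCube_eq_pi]
  exact Bornology.IsBounded.pi fun _ => Metric.isBounded_Ico _ _

theorem _root_.MeasureTheory.LocallyIntegrable.integrableOn_dyadicCube {f : (Fin n → ℝ) → 𝕜}
    (hf : LocallyIntegrable f) (j : ℤ) (m : Fin n → ℤ) : IntegrableOn f (dyadicCube j m) :=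
  (hf.integrableOn_isCompact (isBounded_dyadicCube j m).isCompact_closure).mono_set subset_closure

theorem integrableOn_mul_haarSign {f : (Fin n → ℝ) → 𝕜} {s : Set (Fin n → ℝ)}
    (hf : IntegrableOn f s) (ε : Fin n → ZMod 2) (j : ℤ) :
    IntegrableOn (fun y => f y * (haarSign ε j y : 𝕜)) s := by
  refine Integrable.mul_bdd (c := 1) hf
    (RCLike.measurable_ofReal.comp (measurable_haarSign ε j)).aestronglyMeasurable ?_
  exact Eventually.of_forall fun x => by rw [RCLike.norm_ofReal, abs_haarSign]

/-- By completeness the summed kernel is 2^n times the indicator of the child cube containing x. The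
sum includes ε = 0, whose block is the average over the parent. -/
theorem sum_all_haarBlock {f : (Fin n → ℝ) → 𝕜} (hf : LocallyIntegrable f) (j : ℤ)
    (x : Fin n → ℝ) :
    ∑ ε : Fin n → ZMod 2, haarBlock f ε j x = dyadicAverage f (j + 1) x := by
  have hsub : dyadicCube (j + 1) (cubeIndex (j + 1) x) ⊆ dyadicCube j (cubeIndex j x) :=
    fun y hy => mem_dyadicCube.2
      (cubeIndex_factorsThrough (show j ≤ j + 1 by omega) (mem_dyadicCube.1 hy))
  have hvol : (cubeVolume n j)⁻¹ * 2 ^ n = (cubeVolume n (j + 1))⁻¹ := by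
    rw [cubeVolume, cubeVolume, zpow_add_one₀ two_ne_zero, mul_inv, mul_pow, mul_inv, inv_pow 2]
    simp
  have h1 : ∀ ε : Fin n → ZMod 2, haarBlock f ε j x = ((cubeVolume n j)⁻¹ : ℝ) *
      ∫ y in dyadicCube j (cubeIndex j x),
        f y * ((haarSign ε j y * haarSign ε j x : ℝ) : 𝕜) := by
    intro ε
    rw [haarBlock_eq, dyadicAverage, mul_assoc, ← integral_mul_const]
    simp only [RCLike.ofReal_mul, mul_assoc]
  simp only [h1]
  rw [← Finset.mul_sum, ← integral_finsetSum]
  · have h2 : ∫ y in dyadicCube j (cubeIndex j x), ∑ ε : Fin n → ZMod 2,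
          f y * ((haarSign ε j y * haarSign ε j x : ℝ) : 𝕜)
        = ∫ y in dyadicCube j (cubeIndex j x),
          (dyadicCube (j + 1) (cubeIndex (j + 1) x)).indicator (fun y => (2 ^ n : 𝕜) * f y) y := by
      refine setIntegral_congr_fun (measurableSet_dyadicCube _ _) fun y hy => ?_
      rw [← Finset.mul_sum, ← RCLike.ofReal_sum, sum_haarSign_mul j (mem_dyadicCube.1 hy)]
      by_cases h : cubeIndex (j + 1) y = cubeIndex (j + 1) x
      · simp only [h, Set.indicator, mem_dyadicCube, if_true, mul_comm (f y), RCLike.ofReal_pow,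
          RCLike.ofReal_ofNat]
      · simp [Set.indicator, mem_dyadicCube, h]
    rw [h2, setIntegral_indicator (measurableSet_dyadicCube _ _), Set.inter_eq_right.2 hsub,
      integral_const_mul, dyadicAverage, ← hvol]
    push_cast
    ring
  · intro ε _
    have := (integrableOn_mul_haarSign (hf.integrableOn_dyadicCube j (cubeIndex j x)) ε
      j).mul_const (haarSign ε j x : 𝕜)
    simpa only [RCLike.ofReal_mul, mul_assoc] using this

/-- The part of the Haar expansion of `f` belonging to the generation `j`. -/
def haarLayer (f : (Fin n → ℝ) → 𝕜) (j : ℤ) (x : Fin n → ℝ) : 𝕜 :=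
  ∑ ε : HaarIndex n, haarBlock f ε.1 j x

/-- The sum over `ε` of the squares of the Haar blocks of generation `j`. -/
def squareLayer (f : (Fin n → ℝ) → 𝕜) (j : ℤ) (x : Fin n → ℝ) : ℝ≥0∞ :=
  ∑ ε : HaarIndex n, ‖haarBlock f ε.1 j x‖ₑ ^ 2

theorem haarLayer_eq_sub {f : (Fin n → ℝ) → 𝕜} (hf : LocallyIntegrable f) (j : ℤ)
    (x : Fin n → ℝ) :
    haarLayer f j x = dyadicAverage f (j + 1) x - dyadicAverage f j x := by
  have h0 : haarBlock f 0 j x = dyadicAverage f j x := by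
    rw [haarBlock_eq]; simp [haarSign_zero]
  rw [← sum_all_haarBlock hf, ← h0, ← Finset.add_sum_erase _ _ (Finset.mem_univ 0),
    add_sub_cancel_left, haarLayer]
  exact (Finset.sum_subtype (Finset.univ.erase 0) (p := fun ε : Fin n → ZMod 2 => ε ≠ 0)
    (by simp) fun ε => haarBlock f ε j x).symm

theorem haarLayer_factorsThrough (f : (Fin n → ℝ) → 𝕜) (j : ℤ) :
    Function.FactorsThrough (haarLayer f j) (cubeIndex (j + 1)) := fun x y h => by
  simp only [haarLayer, haarBlock_factorsThrough f _ j h]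

theorem sum_haarLayer {f : (Fin n → ℝ) → 𝕜} (hf : LocallyIntegrable f) (j : ℤ) (N : ℕ)
    (x : Fin n → ℝ) :
    ∑ l ∈ Finset.range N, haarLayer f (j + l) x
      = dyadicAverage f (j + N) x - dyadicAverage f j x := by
  induction N with
  | zero => simp
  | succ N ih =>
    rw [Finset.sum_range_succ, ih, haarLayer_eq_sub hf]
    push_cast
    rw [← add_assoc]
    ring

theorem haarPartialSum_eq {f : (Fin n → ℝ) → 𝕜} (hf : LocallyIntegrable f) (M : ℕ)
    (x : Fin n → ℝ) :
    haarPartialSum f M x = dyadicAverage f (M + 1) x - dyadicAverage f (-M) x := by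
  have h := sum_haarLayer hf (-M) (2 * M + 1) x
  rw [haarPartialSum, Finset.sum_comm]
  have e : -(M : ℤ) + ((2 * M + 1 : ℕ) : ℤ) = M + 1 := by push_cast; ring
  rw [e] at h
  rw [← h]
  refine (Finset.sum_nbij (fun l : ℕ => -(M : ℤ) + l) ?_ ?_ ?_ fun _ _ => rfl).symm
  · intro l hl
    simp only [Finset.mem_range, Finset.mem_Icc] at *
    omega
  · intro l _ l' _ h
    simpa using h
  · intro j hj
    simp only [Finset.coe_Icc, Set.mem_Icc] at hj
    refine ⟨(j + M).toNat, ?_, ?_⟩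
    · simp only [Finset.coe_range, Set.mem_Iio]
      omega
    · simp only
      omega

end Blocks

/-! ### Finite Haar sums as martingales on sampling points. -/

section FiniteEstimates

/-- The sampling is fine enough (j < K) for the sum to be an integral up to a factor. On each cube
of generation j the weight is constant and the sign has mean zero. -/
theorem sum_sampling_mul_haarSign {ε : Fin n → ZMod 2} (hε : ε ≠ 0) {j k K : ℤ} (hkj : k ≤ j)
    (hjK : j < K) (m : Fin n → ℤ) {w : (Fin n → ℝ) → 𝕜}
    (hw : Function.FactorsThrough w (cubeIndex j)) :
    ∑ x ∈ sampling k m K, w x * (haarSign ε j x : 𝕜) = 0 := by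
  have hF : Function.FactorsThrough (fun x => w x * (haarSign ε j x : 𝕜)) (cubeIndex (j + 1)) :=
    fun x y h => by
      simp only [haarSign_factorsThrough ε j h,
        hw (cubeIndex_factorsThrough (show j ≤ j + 1 by omega) h)]
  have hFK : Function.FactorsThrough (fun x => w x * (haarSign ε j x : 𝕜)) (cubeIndex K) :=
    fun x y h => hF (cubeIndex_factorsThrough (show j + 1 ≤ K by omega) h)
  have hsgn : ∀ m', IntegrableOn (fun x => (haarSign ε j x : 𝕜)) (dyadicCube j m') := by
    intro m'
    have := integrableOn_mul_haarSign (𝕜 := 𝕜) (f := fun _ => 1) (s := dyadicCube j m')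
      (integrableOn_const (by rw [volume_dyadicCube]; exact ENNReal.ofReal_ne_top)) ε j
    simpa using this
  have hcongr : ∀ m', Set.EqOn (fun x => w x * (haarSign ε j x : 𝕜))
      (fun x => w (corner j m') * (haarSign ε j x : 𝕜)) (dyadicCube j m') := fun m' x hx => by
    simp only [eqOn_of_factorsThrough hw m' hx]
  have h1 := integral_eq_sum_sampling (show k ≤ K by omega) m hFK
  rw [integral_eq_sum_subcubes hkj m fun m' => IntegrableOn.congr_fun ((hsgn m').const_mul _)
      (hcongr m').symm (measurableSet_dyadicCube j m'), Finset.sum_eq_zero] at h1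
  · exact (smul_eq_zero.1 h1.symm).resolve_left (cubeVolume_pos K).ne'
  · intro m' _
    rw [setIntegral_congr_fun (measurableSet_dyadicCube j m') (hcongr m'), integral_const_mul,
      integral_ofReal, integral_haarSign hε, RCLike.ofReal_zero, mul_zero]

/-- The Euclidean norm of the Haar blocks of generation `j`. -/
def layerNorm (f : (Fin n → ℝ) → 𝕜) (j : ℤ) (x : Fin n → ℝ) : ℝ :=
  Real.sqrt (∑ ε : HaarIndex n, ‖haarBlock f ε.1 j x‖ ^ 2)

theorem layerNorm_sq (f : (Fin n → ℝ) → 𝕜) (j : ℤ) (x : Fin n → ℝ) :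
    layerNorm f j x ^ 2 = ∑ ε : HaarIndex n, ‖haarBlock f ε.1 j x‖ ^ 2 :=
  Real.sq_sqrt (Finset.sum_nonneg fun _ _ => sq_nonneg _)

theorem layerNorm_factorsThrough (f : (Fin n → ℝ) → 𝕜) (j : ℤ) :
    Function.FactorsThrough (layerNorm f j) (cubeIndex j) := fun x y h => by
  simp only [layerNorm]
  congr 1
  exact Finset.sum_congr rfl fun ε _ => congrArg (· ^ 2) (norm_haarBlock_factorsThrough f ε.1 j h)

theorem norm_haarLayer_le (f : (Fin n → ℝ) → 𝕜) (j : ℤ) (x : Fin n → ℝ) :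
    ‖haarLayer f j x‖ ≤ Fintype.card (HaarIndex n) * |layerNorm f j x| := by
  rw [haarLayer, abs_of_nonneg (show 0 ≤ layerNorm f j x from Real.sqrt_nonneg _), ← nsmul_eq_mul]
  refine (norm_sum_le _ _).trans (Finset.sum_le_card_nsmul _ _ _ fun ε _ => ?_)
  refine Real.le_sqrt_of_sq_le ?_
  exact Finset.single_le_sum (f := fun ε : HaarIndex n => ‖haarBlock f ε.1 j x‖ ^ 2)
    (fun _ _ => sq_nonneg _) (Finset.mem_univ ε)

theorem isMartingaleDifference_haarLayer (f : (Fin n → ℝ) → 𝕜) (k : ℤ) (m : Fin n → ℤ) (N : ℕ) :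
    IsMartingaleDifference (sampling k m (k + N)) (fun l => cubeIndex (k + l)) N
      fun l => haarLayer f (k + l) where
  refines j l h := cubeIndex_factorsThrough (by omega)
  adapted l := by
    have := haarLayer_factorsThrough f (k + l)
    rwa [add_assoc] at this
  sum_eq_zero l hl w hw := by
    simp only [haarLayer, Finset.mul_sum]
    rw [Finset.sum_comm]
    refine Finset.sum_eq_zero fun ε _ => ?_
    simp only [haarBlock_eq, ← mul_assoc]
    refine sum_sampling_mul_haarSign ε.2 (by omega) (by omega) m fun x y h => ?_
    simp only [hw h, dyadicAverage_factorsThrough _ _ h]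

/-- In the expanded square, the mixed term for ε ≠ ε' carries the sign of index ε + ε' ≠ 0, which
sums to zero against functions constant on cubes of generation j. This supplies the conditional
expectation hypothesis of `exists_square_le_martingale`. -/
theorem sum_mul_norm_haarLayer_sq (f : (Fin n → ℝ) → 𝕜) {j k K : ℤ} (hkj : k ≤ j)
    (hjK : j < K) (m : Fin n → ℤ) {w : (Fin n → ℝ) → ℝ}
    (hw : Function.FactorsThrough w (cubeIndex j)) :
    ∑ x ∈ sampling k m K, w x * ‖haarLayer f j x‖ ^ 2
      = ∑ x ∈ sampling k m K, w x * layerNorm f j x ^ 2 := by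
  apply RCLike.ofReal_injective (K := 𝕜)
  have h1 : ∀ x, ((w x * ‖haarLayer f j x‖ ^ 2 : ℝ) : 𝕜) = ∑ ε : HaarIndex n, ∑ ε' : HaarIndex n,
      (w x : 𝕜) * (star (haarBlock f ε.1 j x) * haarBlock f ε'.1 j x) := by
    intro x
    have : star (haarLayer f j x) * haarLayer f j x = (‖haarLayer f j x‖ : 𝕜) ^ 2 :=
      RCLike.conj_mul _
    rw [RCLike.ofReal_mul, RCLike.ofReal_pow, ← this, haarLayer, star_sum, Finset.sum_mul_sum,
      Finset.mul_sum]
    simp only [Finset.mul_sum]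
  have h2 : ∀ x, ((w x * layerNorm f j x ^ 2 : ℝ) : 𝕜) = ∑ ε : HaarIndex n,
      (w x : 𝕜) * (star (haarBlock f ε.1 j x) * haarBlock f ε.1 j x) := by
    intro x
    rw [layerNorm_sq, RCLike.ofReal_mul, RCLike.ofReal_sum, Finset.mul_sum]
    refine Finset.sum_congr rfl fun ε _ => ?_
    rw [RCLike.ofReal_pow]
    exact congrArg _ (RCLike.conj_mul _).symm
  rw [RCLike.ofReal_sum, RCLike.ofReal_sum, Finset.sum_congr rfl fun x _ => h1 x,
    Finset.sum_congr rfl fun x _ => h2 x, Finset.sum_comm, Finset.sum_comm (s := sampling k m K)]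
  refine Finset.sum_congr rfl fun ε _ => ?_
  rw [Finset.sum_comm]
  refine Finset.sum_eq_single ε (fun ε' _ hne => ?_) (by simp)
  have hne' : ε.1 + ε'.1 ≠ 0 := fun h => hne <| Subtype.ext <| funext fun i => by
    have := congrFun h i
    simp only [Pi.add_apply, Pi.zero_apply] at this
    exact (CharTwo.add_eq_zero.1 this).symm
  rw [← sum_sampling_mul_haarSign (𝕜 := 𝕜) hne' hkj hjK m
    (w := fun x => (w x : 𝕜) * (star (dyadicAverage (fun y => f y * (haarSign ε.1 j y : 𝕜)) j x)
      * dyadicAverage (fun y => f y * (haarSign ε'.1 j y : 𝕜)) j x)) fun x y h => ?_]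
  · refine Finset.sum_congr rfl fun x _ => ?_
    rw [haarBlock_eq, haarBlock_eq, ← haarSign_mul, star_mul', RCLike.ofReal_mul]
    simp only [RCLike.star_def, RCLike.conj_ofReal]
    ring
  · simp only [hw h, dyadicAverage_factorsThrough _ _ h]

theorem squareLayer_eq (f : (Fin n → ℝ) → 𝕜) (j : ℤ) (x : Fin n → ℝ) :
    squareLayer f j x = ENNReal.ofReal (layerNorm f j x ^ 2) := by
  rw [layerNorm_sq, ENNReal.ofReal_sum_of_nonneg fun _ _ => sq_nonneg _, squareLayer]
  refine Finset.sum_congr rfl fun ε _ => ?_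
  rw [ENNReal.ofReal_pow (norm_nonneg _), ofReal_norm]

theorem squareLayer_factorsThrough (f : (Fin n → ℝ) → 𝕜) (j : ℤ) :
    Function.FactorsThrough (squareLayer f j) (cubeIndex j) := fun x y h => by
  rw [squareLayer_eq, squareLayer_eq, layerNorm_factorsThrough f j h]

theorem lintegral_sum_haarLayer_eq {q : ℝ} (hq : 0 ≤ q) (f : (Fin n → ℝ) → 𝕜) (k : ℤ)
    (m : Fin n → ℤ) (N : ℕ) :
    ∫⁻ x in dyadicCube k m, ‖∑ l ∈ Finset.range N, haarLayer f (k + l) x‖ₑ ^ q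
      = ENNReal.ofReal (∑ x ∈ sampling k m (k + N),
        ‖partialSum (fun l => haarLayer f (k + l)) N x‖ ^ q)
        * ENNReal.ofReal (cubeVolume n (k + N)) := by
  rw [lintegral_eq_sum_sampling (k := k + N) (by omega) m fun x y h => ?_,
    ENNReal.ofReal_sum_of_nonneg fun _ _ => by positivity]
  · congr 1
    refine Finset.sum_congr rfl fun x _ => ?_
    rw [← ENNReal.ofReal_rpow_of_nonneg (norm_nonneg _) hq, ofReal_norm]
    rfl
  · have := (isMartingaleDifference_haarLayer f k m N).factorsThrough_partialSum N h
    simp only [partialSum] at this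
    simp only [this]

theorem lintegral_sum_squareLayer_eq {q : ℝ} (hq : 0 ≤ q) (f : (Fin n → ℝ) → 𝕜) (k : ℤ)
    (m : Fin n → ℤ) (N : ℕ) :
    ∫⁻ x in dyadicCube k m, (∑ l ∈ Finset.range N, squareLayer f (k + l) x) ^ q
      = ENNReal.ofReal (∑ x ∈ sampling k m (k + N),
        sumSq (fun l => layerNorm f (k + l)) N x ^ q)
        * ENNReal.ofReal (cubeVolume n (k + N)) := by
  have e : ∀ x, ∑ l ∈ Finset.range N, squareLayer f (k + l) x
      = ENNReal.ofReal (sumSq (fun l : ℕ => layerNorm f (k + l)) N x) := by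
    intro x
    rw [sumSq, ENNReal.ofReal_sum_of_nonneg fun _ _ => sq_nonneg _]
    simp only [squareLayer_eq]
  rw [lintegral_eq_sum_sampling (k := k + N) (by omega) m fun x y h => ?_,
    ENNReal.ofReal_sum_of_nonneg fun _ _ => Real.rpow_nonneg (sumSq_nonneg _ _) _]
  · congr 1
    refine Finset.sum_congr rfl fun x _ => ?_
    rw [e, ENNReal.ofReal_rpow_of_nonneg (sumSq_nonneg _ _) hq]
  · congr 1
    refine Finset.sum_congr rfl fun l hl => squareLayer_factorsThrough f _ ?_
    exact cubeIndex_factorsThrough (by have := Finset.mem_range.1 hl; omega) h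

variable (𝕜 n) in
/-- Local square function estimates on dyadic cubes for finite Haar sums. -/
theorem exists_finite_square_estimates {q : ℝ} (hq : 1 < q) :
    ∃ K : ℝ≥0, ∀ (f : (Fin n → ℝ) → 𝕜) (k : ℤ) (m : Fin n → ℤ) (N : ℕ),
      (∫⁻ x in dyadicCube k m, ‖∑ l ∈ Finset.range N, haarLayer f (k + l) x‖ₑ ^ q
        ≤ K * ∫⁻ x in dyadicCube k m, (∑ l ∈ Finset.range N, squareLayer f (k + l) x) ^ (q / 2)) ∧
      (∫⁻ x in dyadicCube k m, (∑ l ∈ Finset.range N, squareLayer f (k + l) x) ^ (q / 2)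
        ≤ K * ∫⁻ x in dyadicCube k m, ‖∑ l ∈ Finset.range N, haarLayer f (k + l) x‖ₑ ^ q) := by
  set c : ℝ := ((Fintype.card (HaarIndex n) : ℕ) : ℝ)
  obtain ⟨A, hA0, hA⟩ := exists_martingaleLeSquare (X := Fin n → ℝ) (ι := Fin n → ℤ) (𝕜 := 𝕜) c hq
  obtain ⟨B, hB0, hB⟩ := exists_square_le_martingale (X := Fin n → ℝ) (ι := Fin n → ℤ) (𝕜 := 𝕜)
    c hq
  refine ⟨(max A B).toNNReal, fun f k m N => ?_⟩
  have hmd := isMartingaleDifference_haarLayer f k m N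
  have hK : (((max A B).toNNReal : ℝ≥0) : ℝ≥0∞) = ENNReal.ofReal (max A B) := rfl
  have hAB : 0 ≤ max A B := le_max_of_le_left hA0
  rw [lintegral_sum_haarLayer_eq (by linarith), lintegral_sum_squareLayer_eq (by linarith), hK,
    ← mul_assoc, ← mul_assoc, ← ENNReal.ofReal_mul hAB, ← ENNReal.ofReal_mul hAB]
  constructor
  · gcongr
    refine (hA _ _ N _ (fun l => layerNorm f (k + l)) hmd
      (fun l => layerNorm_factorsThrough f _) fun l x => norm_haarLayer_le f _ x).trans ?_
    exact mul_le_mul_of_nonneg_right (le_max_left _ _)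
      (Finset.sum_nonneg fun _ _ => Real.rpow_nonneg (sumSq_nonneg _ _) _)
  · gcongr
    refine (hB _ _ N _ (fun l => layerNorm f (k + l)) hmd
      (fun l => layerNorm_factorsThrough f _) (fun l x => norm_haarLayer_le f _ x)
      fun l hl w hw => sum_mul_norm_haarLayer_sq f (by omega) (by omega) m hw).trans ?_
    exact mul_le_mul_of_nonneg_right (le_max_right _ _)
      (Finset.sum_nonneg fun _ _ => by positivity)

end FiniteEstimates

/-! ### Passage to the limit: square function estimates on a cube. -/

section LocalEstimates

theorem ennreal_add_rpow_le {q : ℝ} (hq : 0 ≤ q) (a b : ℝ≥0∞) :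
    (a + b) ^ q ≤ 2 ^ q * (a ^ q + b ^ q) := by
  have : a + b ≤ 2 * max a b := by
    rw [two_mul]; exact add_le_add (le_max_left a b) (le_max_right a b)
  calc (a + b) ^ q ≤ (2 * max a b) ^ q := by gcongr
    _ = 2 ^ q * (max a b) ^ q := ENNReal.mul_rpow_of_nonneg _ _ hq
    _ ≤ _ := by
      gcongr
      rcases max_choice a b with h | h <;> rw [h]
      · exact le_self_add
      · exact le_add_self

theorem enorm_sub_rpow_le {q : ℝ} (hq : 0 ≤ q) (a b : 𝕜) :
    ‖a - b‖ₑ ^ q ≤ 2 ^ q * (‖a‖ₑ ^ q + ‖b‖ₑ ^ q) :=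
  (ENNReal.rpow_le_rpow enorm_sub_le hq).trans (ennreal_add_rpow_le hq _ _)

/-- Fatou's lemma for a sequence with bounded integrals that converges almost everywhere. -/
theorem lintegral_le_of_ae_tendsto {α : Type*} [MeasurableSpace α] {μ : Measure α}
    {F : ℕ → α → ℝ≥0∞} {G : α → ℝ≥0∞} {C : ℝ≥0∞} (hF : ∀ N, AEMeasurable (F N) μ)
    (hlim : ∀ᵐ x ∂μ, Tendsto (fun N => F N x) atTop (𝓝 (G x))) (hC : ∀ N, ∫⁻ x, F N x ∂μ ≤ C) :
    ∫⁻ x, G x ∂μ ≤ C := by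
  rw [lintegral_congr_ae (g := fun x => liminf (fun N => F N x) atTop)
    (hlim.mono fun x hx => hx.liminf_eq.symm)]
  exact (lintegral_liminf_le' hF).trans
    (liminf_le_of_frequently_le' (Frequently.of_forall hC))

theorem enorm_dyadicAverage_le (f : (Fin n → ℝ) → 𝕜) (j : ℤ) (x : Fin n → ℝ) :
    ‖dyadicAverage f j x‖ₑ
      ≤ (ENNReal.ofReal (cubeVolume n j))⁻¹ * ∫⁻ y in dyadicCube j (cubeIndex j x), ‖f y‖ₑ := by
  have hv := cubeVolume_pos (n := n) j
  rw [dyadicAverage, enorm_mul, ← ENNReal.ofReal_inv_of_pos hv]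
  refine mul_le_mul' (le_of_eq ?_) (enorm_integral_le_lintegral_enorm _)
  rw [← ofReal_norm, RCLike.norm_ofReal, abs_of_pos (inv_pos.2 hv)]

theorem lintegral_enorm_le_rpow {q : ℝ} (hq : 1 ≤ q) {f : (Fin n → ℝ) → 𝕜}
    (hf : AEStronglyMeasurable f) (j : ℤ) (m : Fin n → ℤ) :
    ∫⁻ y in dyadicCube j m, ‖f y‖ₑ ≤ (∫⁻ y in dyadicCube j m, ‖f y‖ₑ ^ q) ^ (1 / q) *
      ENNReal.ofReal (cubeVolume n j) ^ (1 - 1 / q) := by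
  have hq0 : 0 < q := by linarith
  have := eLpNorm_le_eLpNorm_mul_rpow_measure_univ (μ := volume.restrict (dyadicCube j m))
    (p := 1) (q := ENNReal.ofReal q) (f := f) (ENNReal.one_le_ofReal.2 hq) hf.restrict
  rwa [eLpNorm_one_eq_lintegral_enorm, eLpNorm_eq_lintegral_rpow_enorm_toReal
    (by simpa using hq0) ENNReal.ofReal_ne_top, ENNReal.toReal_ofReal hq0.le,
    Measure.restrict_apply_univ, volume_dyadicCube, ENNReal.toReal_one, div_one] at this

theorem enorm_dyadicAverage_rpow_le {q : ℝ} (hq : 1 ≤ q) {f : (Fin n → ℝ) → 𝕜}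
    (hf : AEStronglyMeasurable f) (j : ℤ) (x : Fin n → ℝ) :
    ‖dyadicAverage f j x‖ₑ ^ q * ENNReal.ofReal (cubeVolume n j)
      ≤ ∫⁻ y in dyadicCube j (cubeIndex j x), ‖f y‖ₑ ^ q := by
  have hq0 : 0 < q := by linarith
  set v := ENNReal.ofReal (cubeVolume n j) with hv
  have hv0 : v ≠ 0 := by simpa [hv] using cubeVolume_pos j
  have hvt : v ≠ ∞ := ENNReal.ofReal_ne_top
  set I := ∫⁻ y in dyadicCube j (cubeIndex j x), ‖f y‖ₑ ^ q with hI
  have h1 : ‖dyadicAverage f j x‖ₑ ≤ v ^ (-(1 / q)) * I ^ (1 / q) := by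
    calc _ ≤ v⁻¹ * (I ^ (1 / q) * v ^ (1 - 1 / q)) := (enorm_dyadicAverage_le f j x).trans
          (mul_le_mul_right (lintegral_enorm_le_rpow hq hf j _) _)
      _ = v ^ (-1 : ℝ) * v ^ (1 - 1 / q) * I ^ (1 / q) := by rw [ENNReal.rpow_neg_one]; ring
      _ = _ := by rw [← ENNReal.rpow_add _ _ hv0 hvt]; congr 2; ring
  calc _ ≤ (v ^ (-(1 / q)) * I ^ (1 / q)) ^ q * v := by gcongr
    _ = v ^ (-1 : ℝ) * v ^ (1 : ℝ) * I := by
      rw [ENNReal.mul_rpow_of_nonneg _ _ hq0.le, ← ENNReal.rpow_mul, ← ENNReal.rpow_mul,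
        neg_mul, one_div_mul_cancel hq0.ne', ENNReal.rpow_one, ENNReal.rpow_one]
      ring
    _ = I := by rw [← ENNReal.rpow_add _ _ hv0 hvt]; simp

/-- Averaging is a contraction of L^q, by Hölder's inequality on each cube of generation j. -/
theorem lintegral_dyadicAverage_rpow_le {q : ℝ} (hq : 1 ≤ q) {f : (Fin n → ℝ) → 𝕜}
    (hf : AEStronglyMeasurable f) {k j : ℤ} (hkj : k ≤ j) (m : Fin n → ℤ) :
    ∫⁻ x in dyadicCube k m, ‖dyadicAverage f j x‖ₑ ^ q
      ≤ ∫⁻ x in dyadicCube k m, ‖f x‖ₑ ^ q := by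
  rw [lintegral_eq_sum_subcubes hkj, lintegral_eq_sum_subcubes hkj]
  refine Finset.sum_le_sum fun m' _ => ?_
  rw [lintegral_of_factorsThrough fun x y h => by simp only [dyadicAverage_factorsThrough f j h]]
  simpa only [cubeIndex_corner] using enorm_dyadicAverage_rpow_le hq hf j (corner j m')

/-- In the sup metric a cube is a ball up to its boundary, so differentiation along balls applies to
dyadic cubes. -/
theorem dyadicCube_ae_eq_closedBall (j : ℤ) (m : Fin n → ℤ) :
    dyadicCube j m =ᵐ[volume]
      Metric.closedBall (fun i => ((m i : ℝ) + 1 / 2) / 2 ^ j) (((2 : ℝ) ^ j)⁻¹ / 2) := by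
  have e : Metric.closedBall (fun i => ((m i : ℝ) + 1 / 2) / 2 ^ j) (((2 : ℝ) ^ j)⁻¹ / 2)
      = Set.Icc (fun i => (m i : ℝ) / 2 ^ j) (fun i => ((m i : ℝ) + 1) / 2 ^ j) := by
    rw [closedBall_pi _ (by positivity), ← Set.pi_univ_Icc]
    congr 1
    funext i
    rw [Real.Icc_eq_closedBall]
    congr 1 <;> ring
  rw [e, dyadicCube_eq_pi]
  exact Measure.univ_pi_Ico_ae_eq_Icc

/-- The Lebesgue differentiation theorem along dyadic cubes. -/
theorem ae_tendsto_dyadicAverage {f : (Fin n → ℝ) → 𝕜} (hf : LocallyIntegrable f) (k : ℤ) :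
    ∀ᵐ x, Tendsto (fun N : ℕ => dyadicAverage f (k + N) x) atTop (𝓝 (f x)) := by
  -- The balls are not centred at x; the parameter 1 asks only that x lie in each of them.
  filter_upwards [IsUnifLocDoublingMeasure.ae_tendsto_average volume hf 1] with x hx
  have e : ∀ j, dyadicAverage f j x
      = ⨍ y in Metric.closedBall (fun i => ((cubeIndex j x i : ℝ) + 1 / 2) / 2 ^ j)
        (((2 : ℝ) ^ j)⁻¹ / 2), f y := by
    intro j
    rw [← setAverage_congr (dyadicCube_ae_eq_closedBall j (cubeIndex j x)), setAverage_eq,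
      volume_real_dyadicCube, dyadicAverage, RCLike.real_smul_eq_coe_mul]
  simp only [e]
  refine hx _ _ (tendsto_nhdsWithin_iff.2 ⟨?_, Eventually.of_forall fun N => ?_⟩)
    (Eventually.of_forall fun N => ?_)
  · have h1 : ∀ N : ℕ, ((2 : ℝ) ^ (k + (N : ℤ)))⁻¹ / 2 = ((2 : ℝ) ^ k)⁻¹ / 2 * (1 / 2) ^ N := by
      intro N
      rw [zpow_add₀ two_ne_zero, zpow_natCast, mul_inv, one_div, inv_pow]; ring
    simp only [h1]
    simpa using (tendsto_pow_atTop_nhds_zero_of_lt_one (r := (1 / 2 : ℝ)) (by norm_num)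
      (by norm_num)).const_mul (((2 : ℝ) ^ k)⁻¹ / 2)
  · exact Set.mem_Ioi.2 (by positivity)
  · rw [one_mul, closedBall_pi _ (by positivity)]
    intro i _
    rw [Metric.mem_closedBall, Real.dist_eq]
    have h := self_mem_dyadicCube (k + N) x i
    have h2 : ((cubeIndex (k + N) x i : ℝ) + 1) / 2 ^ (k + (N : ℤ))
      = (cubeIndex (k + N) x i : ℝ) / 2 ^ (k + (N : ℤ)) + ((2 : ℝ) ^ (k + (N : ℤ)))⁻¹ := by ring
    have h3 : ((cubeIndex (k + N) x i : ℝ) + 1 / 2) / 2 ^ (k + (N : ℤ))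
      = (cubeIndex (k + N) x i : ℝ) / 2 ^ (k + (N : ℤ)) + ((2 : ℝ) ^ (k + (N : ℤ)))⁻¹ / 2 := by ring
    rw [h3, abs_le]
    have h1 := h.1
    have h4 := h.2
    rw [h2] at h4
    constructor <;> linarith

theorem measurable_dyadicAverage (f : (Fin n → ℝ) → 𝕜) (j : ℤ) :
    Measurable (dyadicAverage f j) :=
  measurable_of_factorsThrough (dyadicAverage_factorsThrough f j)

theorem measurable_squareLayer (f : (Fin n → ℝ) → 𝕜) (j : ℤ) : Measurable (squareLayer f j) :=
  measurable_of_factorsThrough (squareLayer_factorsThrough f j)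

/-- The sum of the squares of all Haar blocks of generation at least `k`. -/
def squareTail (f : (Fin n → ℝ) → 𝕜) (k : ℤ) (x : Fin n → ℝ) : ℝ≥0∞ :=
  ∑' l : ℕ, squareLayer f (k + l) x

theorem measurable_squareTail (f : (Fin n → ℝ) → 𝕜) (k : ℤ) : Measurable (squareTail f k) :=
  Measurable.tsum fun l => measurable_squareLayer f (k + l)

variable (𝕜 n) in
/-- Local square function estimates on dyadic cubes. -/
theorem exists_square_estimates {q : ℝ} (hq : 1 < q) :
    ∃ K : ℝ≥0, ∀ (f : (Fin n → ℝ) → 𝕜), LocallyIntegrable f → ∀ (k : ℤ) (m : Fin n → ℤ),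
      (∀ j, k ≤ j → ∫⁻ x in dyadicCube k m, ‖f x - dyadicAverage f j x‖ₑ ^ q
        ≤ K * ∫⁻ x in dyadicCube k m, squareTail f j x ^ (q / 2)) ∧
      (∫⁻ x in dyadicCube k m, squareTail f k x ^ (q / 2)
        ≤ K * ∫⁻ x in dyadicCube k m, ‖f x‖ₑ ^ q) := by
  obtain ⟨K, hK⟩ := exists_finite_square_estimates 𝕜 n hq
  have hq0 : 0 ≤ q := by linarith
  refine ⟨max K (K * (2 ^ q * 2)), fun f hf k m => ⟨fun j hkj => ?_, ?_⟩⟩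
  · have key : ∀ m', ∫⁻ x in dyadicCube j m', ‖f x - dyadicAverage f j x‖ₑ ^ q
        ≤ K * ∫⁻ x in dyadicCube j m', squareTail f j x ^ (q / 2) := by
      intro m'
      refine lintegral_le_of_ae_tendsto
        (F := fun N x => ‖dyadicAverage f (j + N) x - dyadicAverage f j x‖ₑ ^ q) (fun N => ?_) ?_
        fun N => ?_
      · exact (((measurable_dyadicAverage f _).sub
          (measurable_dyadicAverage f _)).enorm.pow_const q).aemeasurable
      · filter_upwards [ae_restrict_of_ae (ae_tendsto_dyadicAverage hf j)] with x hx
        exact (ENNReal.continuous_rpow_const.tendsto _).comp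
          ((hx.sub tendsto_const_nhds).enorm)
      · simp only [← sum_haarLayer hf]
        refine (hK f j m' N).1.trans ?_
        gcongr
        exact ENNReal.sum_le_tsum _
    rw [lintegral_eq_sum_subcubes hkj, lintegral_eq_sum_subcubes hkj, Finset.mul_sum]
    refine Finset.sum_le_sum fun m' _ => (key m').trans ?_
    gcongr
    exact le_max_left _ _
  · refine lintegral_le_of_ae_tendsto
        (F := fun N x => (∑ l ∈ Finset.range N, squareLayer f (k + l) x) ^ (q / 2)) (fun N => ?_)
        (Eventually.of_forall fun x => ?_) fun N => ?_
    · exact ((Finset.measurable_fun_sum _ fun (l : ℕ) _ =>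
        measurable_squareLayer f (k + l)).pow_const _).aemeasurable
    · exact (ENNReal.continuous_rpow_const.tendsto _).comp (ENNReal.tendsto_nat_tsum _)
    · refine (hK f k m N).2.trans ?_
      simp only [sum_haarLayer hf]
      have h1 := lintegral_dyadicAverage_rpow_le hq.le hf.aestronglyMeasurable
        (show k ≤ k + N by omega) m
      have h2 := lintegral_dyadicAverage_rpow_le hq.le hf.aestronglyMeasurable (le_refl k) m
      calc _ ≤ K * ∫⁻ x in dyadicCube k m,
            2 ^ q * (‖dyadicAverage f (k + N) x‖ₑ ^ q + ‖dyadicAverage f k x‖ₑ ^ q) := by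
            gcongr with x
            exact enorm_sub_rpow_le hq0 _ _
        _ = K * (2 ^ q * ((∫⁻ x in dyadicCube k m, ‖dyadicAverage f (k + N) x‖ₑ ^ q)
            + ∫⁻ x in dyadicCube k m, ‖dyadicAverage f k x‖ₑ ^ q)) := by
            rw [lintegral_const_mul, lintegral_add_left]
            · exact (measurable_dyadicAverage f _).enorm.pow_const q
            · exact ((measurable_dyadicAverage f _).enorm.pow_const q).add
                ((measurable_dyadicAverage f _).enorm.pow_const q)
        _ ≤ K * (2 ^ q * ((∫⁻ x in dyadicCube k m, ‖f x‖ₑ ^ q)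
            + ∫⁻ x in dyadicCube k m, ‖f x‖ₑ ^ q)) := by gcongr
        _ = ((K * (2 ^ q * 2) : ℝ≥0) : ℝ≥0∞) * ∫⁻ x in dyadicCube k m, ‖f x‖ₑ ^ q := by
            rw [← two_mul, ENNReal.coe_mul, ENNReal.coe_mul,
              ENNReal.coe_rpow_of_nonneg _ hq0]
            push_cast
            ring
        _ ≤ _ := by
            gcongr
            exact le_max_right _ _

end LocalEstimates

/-! ### Scaling of the Morrey norm. -/

section MorreyNorm

variable (n) in
/-- The factor `|Q|^{-1/p}` for the cubes of generation `j`. -/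
def morreyScale (p : ℝ) (j : ℤ) : ℝ := ((2 : ℝ) ^ ((n : ℝ) / p)) ^ j

theorem morreyScale_pos (p : ℝ) (j : ℤ) : 0 < morreyScale n p j := by
  unfold morreyScale; positivity

theorem morreyScale_eq (p : ℝ) (j : ℤ) : morreyScale n p j = cubeVolume n j ^ (-(1 / p)) := by
  have h : cubeVolume n j = (2 : ℝ) ^ (-((j : ℝ) * n)) := by
    rw [cubeVolume, Real.rpow_neg zero_le_two, Real.rpow_mul zero_le_two, Real.rpow_intCast,
      Real.rpow_natCast, inv_pow]
  rw [h, morreyScale, ← Real.rpow_intCast, ← Real.rpow_mul zero_le_two,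
    ← Real.rpow_mul zero_le_two]
  congr 1
  ring

variable (n) in
/-- The ratio of the scaling factors of consecutive generations. -/
def scaleRatio (p : ℝ) : ℝ := ((2 : ℝ) ^ ((n : ℝ) / p))⁻¹

theorem scaleRatio_pos (p : ℝ) : 0 < scaleRatio n p := by
  unfold scaleRatio; positivity

theorem scaleRatio_lt_one {p : ℝ} (hn : 0 < n) (hp : 0 < p) : scaleRatio n p < 1 :=
  inv_lt_one_of_one_lt₀ (Real.one_lt_rpow one_lt_two (by positivity))

theorem morreyScale_sub (p : ℝ) (k : ℤ) (l : ℕ) :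
    morreyScale n p (k - l) = morreyScale n p k * scaleRatio n p ^ l := by
  rw [morreyScale, zpow_sub₀ (by positivity), zpow_natCast, morreyScale, scaleRatio, inv_pow,
    div_eq_mul_inv]

/-- The normalisation of the Morrey norm on a cube of generation `j`. -/
theorem morrey_weight_rpow {p q : ℝ} (hq : 0 < q) (j : ℤ) (A : ℝ≥0∞) :
    (ENNReal.ofReal (cubeVolume n j) ^ (1 / q - 1 / p) * A) ^ q
      = ENNReal.ofReal (cubeVolume n j) * (ENNReal.ofReal (morreyScale n p j) * A) ^ q := by
  have hv := cubeVolume_pos (n := n) j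
  set v := ENNReal.ofReal (cubeVolume n j) with hvdef
  have hv0 : v ≠ 0 := by simpa [hvdef] using hv
  have hvt : v ≠ ∞ := ENNReal.ofReal_ne_top
  rw [morreyScale_eq, ← ENNReal.ofReal_rpow_of_pos hv, ← hvdef, sub_eq_add_neg,
    ENNReal.rpow_add _ _ hv0 hvt, mul_assoc, ENNReal.mul_rpow_of_nonneg _ _ hq.le,
    ← ENNReal.rpow_mul, one_div_mul_cancel hq.ne', ENNReal.rpow_one]

/-- Working form of the norm: the mean of ‖F‖^q over a cube Q is at most (|Q|^(-1/p) A)^q. -/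
theorem morreyNorm_le_iff {α : Type*} [ENorm α] {p q : ℝ} (hq : 0 < q) {F : (Fin n → ℝ) → α}
    {A : ℝ≥0∞} :
    morreyNorm p q F ≤ A ↔ ∀ (j : ℤ) (m : Fin n → ℤ), ∫⁻ y in dyadicCube j m, ‖F y‖ₑ ^ q
      ≤ ENNReal.ofReal (cubeVolume n j) * (ENNReal.ofReal (morreyScale n p j) * A) ^ q := by
  simp only [morreyNorm, iSup_le_iff]
  refine forall_congr' fun j => forall_congr' fun m => ?_
  have hv := cubeVolume_pos (n := n) j
  rw [← morrey_weight_rpow hq, volume_dyadicCube]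
  set v := ENNReal.ofReal (cubeVolume n j) with hvdef
  have hv0 : v ≠ 0 := by simpa [hvdef] using hv
  have hvt : v ≠ ∞ := ENNReal.ofReal_ne_top
  rw [show 1 / p - 1 / q = -(1 / q - 1 / p) by ring, ENNReal.rpow_neg,
    ENNReal.inv_mul_le_iff (by simp [hv0, hvt]) (by simp [hv0, hvt]),
    ← ENNReal.rpow_le_rpow_iff hq, ← ENNReal.rpow_mul, one_div_mul_cancel hq.ne',
    ENNReal.rpow_one]

theorem lintegral_rpow_le_morreyNorm {α : Type*} [ENorm α] (p : ℝ) {q : ℝ} (hq : 0 < q)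
    (F : (Fin n → ℝ) → α) (j : ℤ) (m : Fin n → ℤ) :
    ∫⁻ y in dyadicCube j m, ‖F y‖ₑ ^ q ≤ ENNReal.ofReal (cubeVolume n j) *
      (ENNReal.ofReal (morreyScale n p j) * morreyNorm p q F) ^ q :=
  (morreyNorm_le_iff hq).1 le_rfl j m

theorem morreyNorm_le_of_forall {α : Type*} [ENorm α] {p q : ℝ} (hq : 0 < q)
    {F : (Fin n → ℝ) → α} {D : ℝ≥0} {A : ℝ≥0∞}
    (h : ∀ (j : ℤ) (m : Fin n → ℤ), ∫⁻ y in dyadicCube j m, ‖F y‖ₑ ^ q ≤ D *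
      (ENNReal.ofReal (cubeVolume n j) * (ENNReal.ofReal (morreyScale n p j) * A) ^ q)) :
    morreyNorm p q F ≤ (D ^ (1 / q) : ℝ≥0) * A := by
  refine (morreyNorm_le_iff hq).2 fun j m => (h j m).trans_eq ?_
  rw [mul_left_comm _ _ A, ENNReal.mul_rpow_of_nonneg ((D ^ (1 / q) : ℝ≥0) : ℝ≥0∞) _ hq.le,
    ENNReal.coe_rpow_of_nonneg _ (by positivity), ← ENNReal.rpow_mul,
    one_div_mul_cancel hq.ne', ENNReal.rpow_one]
  ring

end MorreyNorm

/-! ### Local L^q spaces tested on dyadic cubes. -/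

section LocalSpaces

theorem exists_cover_dyadicCube {K : Set (Fin n → ℝ)} (hK : IsCompact K) (k : ℤ) :
    ∃ T : Finset (Fin n → ℤ), K ⊆ ⋃ m ∈ T, dyadicCube k m := by
  obtain ⟨⟨a, ha⟩, ⟨b, hb⟩⟩ := isBounded_iff_bddBelow_bddAbove.1 hK.isBounded
  have hfin : (cubeIndex k '' K).Finite := by
    refine (Set.finite_Icc (fun i => ⌊(2 : ℝ) ^ k * a i⌋) (fun i => ⌊(2 : ℝ) ^ k * b i⌋)).subset ?_
    rintro _ ⟨y, hy, rfl⟩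
    exact ⟨fun i => Int.floor_le_floor (mul_le_mul_of_nonneg_left (ha hy i) (by positivity)),
      fun i => Int.floor_le_floor (mul_le_mul_of_nonneg_left (hb hy i) (by positivity))⟩
  refine ⟨hfin.toFinset, fun y hy => ?_⟩
  simp only [Set.mem_iUnion, Set.Finite.mem_toFinset, exists_prop]
  exact ⟨_, ⟨y, hy, rfl⟩, self_mem_dyadicCube k y⟩

theorem lintegral_le_sum_of_cover {K : Set (Fin n → ℝ)} {k : ℤ} {T : Finset (Fin n → ℤ)}
    (hT : K ⊆ ⋃ m ∈ T, dyadicCube k m) (F : (Fin n → ℝ) → ℝ≥0∞) :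
    ∫⁻ x in K, F x ≤ ∑ m ∈ T, ∫⁻ x in dyadicCube k m, F x := by
  rw [← lintegral_biUnion_finset ((pairwise_disjoint_dyadicCube k).set_pairwise _)
    fun _ _ => measurableSet_dyadicCube _ _]
  exact lintegral_mono_set hT

theorem memLqLoc_of_lintegral_lt_top {q : ℝ} (hq : 0 < q) {F : (Fin n → ℝ) → 𝕜}
    (hF : AEStronglyMeasurable F) (k : ℤ)
    (h : ∀ m, ∫⁻ x in dyadicCube k m, ‖F x‖ₑ ^ q < ∞) : MemLqLoc q F := by
  intro K hK
  refine ⟨hF.restrict, ?_⟩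
  rw [eLpNorm_lt_top_iff_lintegral_rpow_enorm_lt_top (by simpa using hq) ENNReal.ofReal_ne_top,
    ENNReal.toReal_ofReal hq.le]
  obtain ⟨T, hT⟩ := exists_cover_dyadicCube hK k
  exact (lintegral_le_sum_of_cover hT _).trans_lt (ENNReal.sum_lt_top.2 fun m _ => h m)

theorem memLqLoc_of_factorsThrough {q : ℝ} (hq : 0 < q) {F : (Fin n → ℝ) → 𝕜} {k : ℤ}
    (hF : Function.FactorsThrough F (cubeIndex k)) : MemLqLoc q F := by
  refine memLqLoc_of_lintegral_lt_top hq (measurable_of_factorsThrough hF).aestronglyMeasurable k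
    fun m => ?_
  rw [lintegral_of_factorsThrough fun x y h => by simp only [hF h]]
  exact ENNReal.mul_lt_top (ENNReal.rpow_lt_top_of_nonneg hq.le enorm_ne_top) ENNReal.ofReal_lt_top

theorem MemLqLoc.locallyIntegrable {q : ℝ} (hq : 1 ≤ q) {f : (Fin n → ℝ) → 𝕜}
    (hf : MemLqLoc q f) : LocallyIntegrable f := by
  rw [locallyIntegrable_iff]
  intro K hK
  have : IsFiniteMeasure (volume.restrict K) := ⟨by
    rw [Measure.restrict_apply_univ]; exact hK.measure_lt_top⟩
  exact (hf K hK).integrable (ENNReal.one_le_ofReal.2 hq)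

end LocalSpaces

/-! ### Pointwise bounds for single blocks and for the square tail. -/

section SquareFunction

variable {p q : ℝ}

theorem squareFunction_sq (f : (Fin n → ℝ) → 𝕜) (ε : Fin n → ZMod 2) (x : Fin n → ℝ) :
    squareFunction f ε x ^ 2 = ∑' j : ℤ, ‖haarBlock f ε j x‖ₑ ^ 2 := by
  rw [squareFunction, ← ENNReal.rpow_natCast, ← ENNReal.rpow_mul]
  norm_num

theorem squareFunction_rpow (f : (Fin n → ℝ) → 𝕜) (ε : Fin n → ZMod 2) (x : Fin n → ℝ) (q : ℝ) :
    squareFunction f ε x ^ q = (∑' j : ℤ, ‖haarBlock f ε j x‖ₑ ^ 2) ^ (q / 2) := by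
  rw [← squareFunction_sq, ← ENNReal.rpow_natCast, ← ENNReal.rpow_mul]
  congr 1
  push_cast
  ring

theorem measurable_haarBlock (f : (Fin n → ℝ) → 𝕜) (ε : Fin n → ZMod 2) (j : ℤ) :
    Measurable (haarBlock f ε j) :=
  measurable_of_factorsThrough (haarBlock_factorsThrough f ε j)

theorem measurable_squareFunction (f : (Fin n → ℝ) → 𝕜) (ε : Fin n → ZMod 2) :
    Measurable (squareFunction f ε) :=
  (Measurable.tsum fun j => (measurable_haarBlock f ε j).enorm.pow_const 2).pow_const _

theorem enorm_haarBlock_le_squareFunction (f : (Fin n → ℝ) → 𝕜) (ε : Fin n → ZMod 2) (j : ℤ)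
    (x : Fin n → ℝ) : ‖haarBlock f ε j x‖ₑ ≤ squareFunction f ε x := by
  rw [← ENNReal.rpow_le_rpow_iff two_pos, ENNReal.rpow_two, ENNReal.rpow_two, squareFunction_sq]
  exact ENNReal.le_tsum (f := fun j => ‖haarBlock f ε j x‖ₑ ^ 2) j

theorem morreyNorm_squareFunction_le (f : (Fin n → ℝ) → 𝕜) (ε : HaarIndex n) :
    morreyNorm p q (squareFunction f ε.1) ≤ squareMorreyNorm p q f :=
  Finset.single_le_sum (f := fun ε : HaarIndex n => morreyNorm p q (squareFunction f ε.1))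
    (fun _ _ => zero_le) (Finset.mem_univ ε)

theorem lintegral_squareFunction_rpow_le (p : ℝ) (hq : 0 < q) (f : (Fin n → ℝ) → 𝕜)
    (ε : HaarIndex n) (j : ℤ) (m : Fin n → ℤ) :
    ∫⁻ x in dyadicCube j m, squareFunction f ε.1 x ^ q ≤ ENNReal.ofReal (cubeVolume n j) *
      (ENNReal.ofReal (morreyScale n p j) * squareMorreyNorm p q f) ^ q := by
  have := lintegral_rpow_le_morreyNorm p hq (squareFunction f ε.1) j m
  simp only [enorm_eq_self] at this
  refine this.trans ?_
  gcongr
  exact morreyNorm_squareFunction_le f ε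

theorem le_of_mul_rpow_le (hq : 0 < q) (j : ℤ) {a b : ℝ≥0∞}
    (h : a ^ q * ENNReal.ofReal (cubeVolume n j) ≤ ENNReal.ofReal (cubeVolume n j) * b ^ q) :
    a ≤ b := by
  rw [mul_comm, ENNReal.mul_le_mul_iff_right (by simpa using cubeVolume_pos j)
    ENNReal.ofReal_ne_top] at h
  exact (ENNReal.rpow_le_rpow_iff hq).1 h

/-- The modulus of the block is constant on its cube and at most the square function there, so its
value is bounded by an L^q mean of the square function. -/
theorem enorm_haarBlock_le (p : ℝ) (hq : 0 < q) (f : (Fin n → ℝ) → 𝕜) (ε : HaarIndex n) (j : ℤ)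
    (x : Fin n → ℝ) :
    ‖haarBlock f ε.1 j x‖ₑ ≤ ENNReal.ofReal (morreyScale n p j) * squareMorreyNorm p q f := by
  have hfac : Function.FactorsThrough (fun y => ‖haarBlock f ε.1 j y‖ₑ ^ q) (cubeIndex j) :=
    fun y z h => by
      have := norm_haarBlock_factorsThrough f ε.1 j h
      simp only [← ofReal_norm] at this ⊢
      rw [this]
  have h1 := lintegral_of_factorsThrough hfac (cubeIndex j x)
  have h2 := hfac (cubeIndex_corner j (cubeIndex j x))
  simp only at h2
  rw [h2] at h1
  refine le_of_mul_rpow_le hq j (n := n) (h1.symm.trans_le (le_trans ?_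
    (lintegral_squareFunction_rpow_le p hq f ε j (cubeIndex j x))))
  gcongr
  exact enorm_haarBlock_le_squareFunction f ε.1 j _

theorem enorm_dyadicAverage_mul_le (p : ℝ) (hq : 1 ≤ q) {f h : (Fin n → ℝ) → 𝕜}
    (hh : AEStronglyMeasurable h) (hfh : ∀ x, ‖h x‖ₑ = ‖f x‖ₑ) (j : ℤ) (x : Fin n → ℝ) :
    ‖dyadicAverage h j x‖ₑ ≤ ENNReal.ofReal (morreyScale n p j) * morreyNorm p q f := by
  refine le_of_mul_rpow_le (by linarith) j (n := n)
    ((enorm_dyadicAverage_rpow_le hq hh j x).trans ?_)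
  simp only [hfh]
  exact lintegral_rpow_le_morreyNorm p (by linarith) f j _

theorem enorm_haarBlock_le_morreyNorm (p : ℝ) (hq : 1 ≤ q) {f : (Fin n → ℝ) → 𝕜}
    (hf : AEStronglyMeasurable f) (ε : Fin n → ZMod 2) (j : ℤ) (x : Fin n → ℝ) :
    ‖haarBlock f ε j x‖ₑ ≤ ENNReal.ofReal (morreyScale n p j) * morreyNorm p q f := by
  rw [← ofReal_norm, norm_haarBlock, ofReal_norm]
  refine enorm_dyadicAverage_mul_le p hq (hf.mul
    (RCLike.measurable_ofReal.comp (measurable_haarSign ε j)).aestronglyMeasurable) (fun y => ?_) j x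
  change ‖f y * (haarSign ε j y : 𝕜)‖ₑ = _
  rw [← ofReal_norm, norm_mul, RCLike.norm_ofReal, abs_haarSign, mul_one, ofReal_norm]

theorem squareTail_le (f : (Fin n → ℝ) → 𝕜) (k : ℤ) (x : Fin n → ℝ) :
    squareTail f k x ≤ (∑ ε : HaarIndex n, squareFunction f ε.1 x) ^ 2 := by
  simp only [squareTail, squareLayer]
  rw [Summable.tsum_finsetSum fun _ _ => ENNReal.summable, sq, Finset.sum_mul]
  refine Finset.sum_le_sum fun ε _ => ?_
  calc _ ≤ squareFunction f ε.1 x ^ 2 := by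
        rw [squareFunction_sq]
        exact ENNReal.tsum_comp_le_tsum_of_injective (f := fun l : ℕ => k + (l : ℤ))
          (fun a b h => by simpa using h) fun j => ‖haarBlock f ε.1 j x‖ₑ ^ 2
    _ = squareFunction f ε.1 x * squareFunction f ε.1 x := sq _
    _ ≤ _ := by
        gcongr
        exact Finset.single_le_sum (f := fun ε : HaarIndex n => squareFunction f ε.1 x)
          (fun _ _ => zero_le) (Finset.mem_univ ε)

variable (n) in
theorem exists_lintegral_squareTail_le (p : ℝ) (hq : 1 ≤ q) :
    ∃ D : ℝ≥0, ∀ (f : (Fin n → ℝ) → 𝕜) (k : ℤ) (m : Fin n → ℤ),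
      ∫⁻ x in dyadicCube k m, squareTail f k x ^ (q / 2) ≤ D * (ENNReal.ofReal (cubeVolume n k) *
        (ENNReal.ofReal (morreyScale n p k) * squareMorreyNorm p q f) ^ q) := by
  set c : ℕ := Fintype.card (HaarIndex n) with hc
  refine ⟨(c : ℝ≥0) ^ (q - 1) * c, fun f k m => ?_⟩
  have h1 : ∀ x, squareTail f k x ^ (q / 2)
      ≤ (c : ℝ≥0∞) ^ (q - 1) * ∑ ε : HaarIndex n, squareFunction f ε.1 x ^ q := by
    intro x
    calc _ ≤ ((∑ ε : HaarIndex n, squareFunction f ε.1 x) ^ 2) ^ (q / 2) := by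
          gcongr; exact squareTail_le f k x
      _ = (∑ ε : HaarIndex n, squareFunction f ε.1 x) ^ q := by
        rw [← ENNReal.rpow_two, ← ENNReal.rpow_mul]; congr 1; ring
      _ ≤ _ := ENNReal.rpow_sum_le_const_mul_sum_rpow _ _ hq
  calc _ ≤ ∫⁻ x in dyadicCube k m,
        (c : ℝ≥0∞) ^ (q - 1) * ∑ ε : HaarIndex n, squareFunction f ε.1 x ^ q :=
        lintegral_mono h1
    _ = (c : ℝ≥0∞) ^ (q - 1) * ∑ ε : HaarIndex n,
          ∫⁻ x in dyadicCube k m, squareFunction f ε.1 x ^ q := by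
        rw [lintegral_const_mul, lintegral_finsetSum]
        · exact fun ε _ => (measurable_squareFunction f ε.1).pow_const q
        · exact Finset.measurable_fun_sum _ fun ε _ =>
            (measurable_squareFunction f ε.1).pow_const q
    _ ≤ (c : ℝ≥0∞) ^ (q - 1) * ∑ _ε : HaarIndex n, (ENNReal.ofReal (cubeVolume n k) *
        (ENNReal.ofReal (morreyScale n p k) * squareMorreyNorm p q f) ^ q) := by
        gcongr with ε
        exact lintegral_squareFunction_rpow_le p (by linarith) f ε k m
    _ = _ := by
        rw [Finset.sum_const, Finset.card_univ, nsmul_eq_mul, ENNReal.coe_mul,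
          ENNReal.coe_rpow_of_nonneg _ (by linarith)]
        simp only [ENNReal.coe_natCast, hc]
        ring

end SquareFunction

variable {p q : ℝ}

/-! ### Averages over growing cubes. -/

section LowFrequencies

theorem norm_haarLayer_le_scale (p : ℝ) (hq : 0 < q) {f : (Fin n → ℝ) → 𝕜}
    (hR : squareMorreyNorm p q f ≠ ∞) (j : ℤ) (x : Fin n → ℝ) :
    ‖haarLayer f j x‖ ≤ (Fintype.card (HaarIndex n) : ℕ) *
      (morreyScale n p j * (squareMorreyNorm p q f).toReal) := by
  rw [haarLayer, ← nsmul_eq_mul]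
  refine (norm_sum_le _ _).trans (Finset.sum_le_card_nsmul _ _ _ fun ε _ => ?_)
  have h := ENNReal.toReal_mono (ENNReal.mul_ne_top ENNReal.ofReal_ne_top hR)
    (enorm_haarBlock_le p hq f ε j x)
  rwa [toReal_enorm, ENNReal.toReal_mul, ENNReal.toReal_ofReal (morreyScale_pos p j).le] at h

/-- The averages over increasing dyadic cubes converge geometrically when the square function has
finite Morrey norm. -/
theorem exists_limit_dyadicAverage (hn : 0 < n) (hp : 0 < p) (hq : 0 < q)
    {f : (Fin n → ℝ) → 𝕜} (hf : LocallyIntegrable f) (hR : squareMorreyNorm p q f ≠ ∞) :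
    ∃ c : (Fin n → ℝ) → 𝕜,
      (∀ x, Tendsto (fun l : ℕ => dyadicAverage f (-l) x) atTop (𝓝 (c x))) ∧
      (∀ k, Function.FactorsThrough c (cubeIndex k)) ∧
      ∀ k x, ‖dyadicAverage f k x - c x‖ ≤ (Fintype.card (HaarIndex n) : ℕ) /
        (1 - scaleRatio n p) * (morreyScale n p k * (squareMorreyNorm p q f).toReal) := by
  set N : ℝ := ((Fintype.card (HaarIndex n) : ℕ) : ℝ) with hN
  set R := (squareMorreyNorm p q f).toReal with hRdef
  have hr0 := scaleRatio_pos (n := n) p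
  have hr1 := scaleRatio_lt_one hn hp
  -- Consecutive averages differ by one layer, which is bounded by the geometrically decaying scale.
  have hdist : ∀ (k : ℤ) x (l : ℕ), dist (dyadicAverage f (k - l) x)
      (dyadicAverage f (k - (l + 1 : ℕ)) x)
      ≤ N * (morreyScale n p k * R) * scaleRatio n p ^ l := by
    intro k x l
    have e : k - (l : ℤ) = k - ((l + 1 : ℕ) : ℤ) + 1 := by push_cast; ring
    rw [e, dist_eq_norm, ← haarLayer_eq_sub hf]
    refine (norm_haarLayer_le_scale p hq hR _ x).trans ?_
    rw [morreyScale_sub, pow_succ]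
    have hk := morreyScale_pos (n := n) p k
    have hR0 : 0 ≤ R := ENNReal.toReal_nonneg
    calc N * (morreyScale n p k * (scaleRatio n p ^ l * scaleRatio n p) * R)
        = N * (morreyScale n p k * R) * scaleRatio n p ^ l * scaleRatio n p := by ring
      _ ≤ _ := mul_le_of_le_one_right (by positivity) hr1.le
  have hlim : ∀ x, ∃ c, Tendsto (fun l : ℕ => dyadicAverage f (-l) x) atTop (𝓝 c) := by
    intro x
    refine cauchySeq_tendsto_of_complete (cauchySeq_of_le_geometric (scaleRatio n p)
      (N * (morreyScale n p 0 * R)) hr1 fun l => ?_)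
    simpa only [zero_sub] using hdist 0 x l
  choose c hc using hlim
  have hck : ∀ (k : ℤ) x, Tendsto (fun l : ℕ => dyadicAverage f (k - l) x) atTop (𝓝 (c x)) := by
    intro k x
    rcases le_total 0 k with hk | hk
    · rw [← tendsto_add_atTop_iff_nat k.toNat]
      refine (hc x).congr fun l => ?_
      congr 1
      push_cast
      omega
    · refine ((tendsto_add_atTop_iff_nat (-k).toNat).2 (hc x)).congr fun l => ?_
      congr 1
      push_cast
      omega
  -- Points sharing a cube of generation k share all larger ones, hence the limit.
  refine ⟨c, hc, fun k x y h => ?_, fun k x => ?_⟩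
  · refine tendsto_nhds_unique ((hck k x).congr fun l => ?_) (hck k y)
    exact dyadicAverage_factorsThrough f _ (cubeIndex_factorsThrough (by omega) h)
  · have := dist_le_of_le_geometric_of_tendsto₀ (scaleRatio n p) _ hr1 (hdist k x) (hck k x)
    rw [Nat.cast_zero, sub_zero, dist_eq_norm] at this
    refine this.trans_eq ?_
    ring

/-- The function c is constant on every dyadic cube, so its Haar coefficients vanish. -/
theorem haarBlock_sub_eq {f c : (Fin n → ℝ) → 𝕜} (hf : LocallyIntegrable f)
    (hc : ∀ k, Function.FactorsThrough c (cubeIndex k)) (ε : HaarIndex n) (j : ℤ) :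
    haarBlock (f - c) ε.1 j = haarBlock f ε.1 j := by
  funext x
  rw [haarBlock_eq, haarBlock_eq, dyadicAverage, dyadicAverage]
  congr 2
  have hcongr : Set.EqOn (fun y => c y * (haarSign ε.1 j y : 𝕜))
      (fun y => c x * (haarSign ε.1 j y : 𝕜)) (dyadicCube j (cubeIndex j x)) := fun y hy => by
    simp only [hc j (mem_dyadicCube.1 hy)]
  have h0 : ∫ y in dyadicCube j (cubeIndex j x), c y * (haarSign ε.1 j y : 𝕜) = 0 := by
    rw [setIntegral_congr_fun (measurableSet_dyadicCube _ _) hcongr, integral_const_mul,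
      integral_ofReal, integral_haarSign ε.2, RCLike.ofReal_zero, mul_zero]
  simp only [Pi.sub_apply, sub_mul]
  rw [integral_sub (integrableOn_mul_haarSign (hf.integrableOn_dyadicCube _ _) _ _)
    (integrableOn_mul_haarSign (integrableOn_dyadicCube_of_factorsThrough (hc j) _) _ _), h0,
    sub_zero]

theorem squareMorreyNorm_sub_eq {f c : (Fin n → ℝ) → 𝕜} (hf : LocallyIntegrable f)
    (hc : ∀ k, Function.FactorsThrough c (cubeIndex k)) :
    squareMorreyNorm p q (f - c) = squareMorreyNorm p q f := by
  have : ∀ ε : HaarIndex n, squareFunction (f - c) ε.1 = squareFunction f ε.1 := by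
    intro ε
    funext x
    simp only [squareFunction, haarBlock_sub_eq hf hc ε]
  simp only [squareMorreyNorm, this]

theorem lintegral_dyadicAverage_sub_rpow_le (hq : 0 < q) {f c : (Fin n → ℝ) → 𝕜} {G : ℝ≥0}
    {R : ℝ≥0∞} (hR : R ≠ ∞) {j : ℤ}
    (hG : ∀ x, ‖dyadicAverage f j x - c x‖ ≤ G * (morreyScale n p j * R.toReal)) (k : ℤ)
    (m : Fin n → ℤ) :
    ∫⁻ x in dyadicCube k m, ‖dyadicAverage f j x - c x‖ₑ ^ q
      ≤ G ^ q * (ENNReal.ofReal (cubeVolume n k)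
        * (ENNReal.ofReal (morreyScale n p j) * R) ^ q) := by
  have h1 : ∀ x, ‖dyadicAverage f j x - c x‖ₑ ≤ G * (ENNReal.ofReal (morreyScale n p j) * R) := by
    intro x
    rw [← ofReal_norm]
    refine (ENNReal.ofReal_le_ofReal (hG x)).trans_eq ?_
    rw [ENNReal.ofReal_mul G.coe_nonneg, ENNReal.ofReal_mul (morreyScale_pos p j).le,
      ENNReal.ofReal_toReal hR, ENNReal.ofReal_coe_nnreal]
  calc _ ≤ ∫⁻ _ in dyadicCube k m, (G * (ENNReal.ofReal (morreyScale n p j) * R)) ^ q := by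
        refine lintegral_mono fun x => ?_
        exact ENNReal.rpow_le_rpow (h1 x) hq.le
    _ = _ := by
        rw [setLIntegral_const, volume_dyadicCube,
          ENNReal.mul_rpow_of_nonneg (G : ℝ≥0∞) _ hq.le]
        ring

end LowFrequencies

/-! ### The two Morrey norm estimates. -/

section MorreyEstimates

theorem lintegral_sub_rpow_le (hq : 0 ≤ q) {f a c : (Fin n → ℝ) → 𝕜} (ha : Measurable a)
    (hc : Measurable c) (s : Set (Fin n → ℝ)) :
    ∫⁻ x in s, ‖f x - c x‖ₑ ^ q
      ≤ 2 ^ q * ((∫⁻ x in s, ‖f x - a x‖ₑ ^ q) + ∫⁻ x in s, ‖a x - c x‖ₑ ^ q) := by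
  have hm : Measurable fun x => ‖a x - c x‖ₑ ^ q := (ha.sub hc).enorm.pow_const q
  rw [← lintegral_add_right _ hm, ← lintegral_const_mul' _ _ (by simp)]
  refine lintegral_mono fun x => ?_
  have := ennreal_add_rpow_le hq ‖f x - a x‖ₑ ‖a x - c x‖ₑ
  refine le_trans (ENNReal.rpow_le_rpow ?_ hq) this
  rw [← sub_add_sub_cancel (f x) (a x) (c x)]
  exact enorm_add_le _ _

variable (𝕜) in
-- On a cube of generation k, split f - c into f - E_k f, controlled by the square tail, and E_k f -
-- c, controlled by the assumed rate of convergence.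
theorem exists_morreyNorm_sub_le (hn : 0 < n) (hp : 0 < p) (hq : 1 < q) :
    ∃ C : ℝ≥0, ∀ f c : (Fin n → ℝ) → 𝕜, LocallyIntegrable f → squareMorreyNorm p q f ≠ ∞ →
      (∀ k, Function.FactorsThrough c (cubeIndex k)) →
      (∀ k x, ‖dyadicAverage f k x - c x‖ ≤ (Fintype.card (HaarIndex n) : ℕ) /
        (1 - scaleRatio n p) * (morreyScale n p k * (squareMorreyNorm p q f).toReal)) →
      morreyNorm p q (f - c) ≤ C * squareMorreyNorm p q f := by
  obtain ⟨K, hK⟩ := exists_square_estimates 𝕜 n hq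
  obtain ⟨D, hD⟩ := exists_lintegral_squareTail_le (𝕜 := 𝕜) n p hq.le
  have hr1 := scaleRatio_lt_one hn hp
  have hq0 : 0 < q := by linarith
  set G : ℝ≥0 := ⟨((Fintype.card (HaarIndex n) : ℕ) : ℝ) / (1 - scaleRatio n p),
    div_nonneg (Nat.cast_nonneg _) (by linarith)⟩ with hG
  refine ⟨(2 ^ q * (K * D + G ^ q)) ^ (1 / q), fun f c hf hR hc hcb => ?_⟩
  refine morreyNorm_le_of_forall hq0 fun k m => ?_
  have hcb' : ∀ x, ‖dyadicAverage f k x - c x‖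
      ≤ G * (morreyScale n p k * (squareMorreyNorm p q f).toReal) := fun x => hcb k x
  set V := ENNReal.ofReal (cubeVolume n k) *
    (ENNReal.ofReal (morreyScale n p k) * squareMorreyNorm p q f) ^ q with hV
  calc _ ≤ 2 ^ q * ((∫⁻ x in dyadicCube k m, ‖f x - dyadicAverage f k x‖ₑ ^ q)
        + ∫⁻ x in dyadicCube k m, ‖dyadicAverage f k x - c x‖ₑ ^ q) :=
        lintegral_sub_rpow_le hq0.le (measurable_dyadicAverage f k)
          (measurable_of_factorsThrough (hc 0)) _
    _ ≤ 2 ^ q * (K * (D * V) + G ^ q * V) := by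
        gcongr
        · exact ((hK f hf k m).1 k le_rfl).trans (by gcongr; exact hD f k m)
        · exact lintegral_dyadicAverage_sub_rpow_le hq0 hR hcb' k m
    _ = _ := by
        push_cast
        rw [ENNReal.coe_rpow_of_nonneg _ hq0.le, ENNReal.coe_rpow_of_nonneg _ hq0.le]
        push_cast
        ring

theorem tsum_int_eq_add (g : ℤ → ℝ≥0∞) (k : ℤ) :
    ∑' j, g j = (∑' l : ℕ, g (k + l)) + ∑' l : ℕ, g (k - (l + 1 : ℕ)) := by
  rw [← (Equiv.addLeft k).tsum_eq g]
  have := (ENNReal.summable (f := fun l : ℕ => g (k + l))).hasSum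
  have h2 := (ENNReal.summable (f := fun l : ℕ => g (k + -((l : ℤ) + 1)))).hasSum
  refine (HasSum.of_nat_of_neg_add_one (f := fun j => g (k + j)) this h2).tsum_eq.trans ?_
  simp only [Nat.cast_add, Nat.cast_one, sub_eq_add_neg]

theorem tsum_low_sq_le (ε : Fin n → ZMod 2) {f : (Fin n → ℝ) → 𝕜} {A : ℝ≥0∞}
    (h : ∀ j x, ‖haarBlock f ε j x‖ₑ ≤ ENNReal.ofReal (morreyScale n p j) * A) (k : ℤ)
    (x : Fin n → ℝ) :
    ∑' l : ℕ, ‖haarBlock f ε (k - (l + 1 : ℕ)) x‖ₑ ^ 2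
      ≤ (1 - ENNReal.ofReal (scaleRatio n p) ^ 2)⁻¹
        * (ENNReal.ofReal (morreyScale n p k) * A) ^ 2 * ENNReal.ofReal (scaleRatio n p) ^ 2 := by
  rw [← ENNReal.tsum_geometric, mul_assoc, ← ENNReal.tsum_mul_right]
  refine ENNReal.tsum_le_tsum fun l => ?_
  calc _ ≤ (ENNReal.ofReal (morreyScale n p (k - (l + 1 : ℕ))) * A) ^ 2 := by
        gcongr; exact h _ x
    _ = _ := by
        rw [morreyScale_sub, ENNReal.ofReal_mul (morreyScale_pos p k).le,
          ENNReal.ofReal_pow (scaleRatio_pos p).le]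
        ring

variable (𝕜) in
-- On a cube of generation k, the generations from k on are covered by the local estimate. The lower
-- ones are summed pointwise as a geometric series.
theorem exists_squareMorreyNorm_le (hn : 0 < n) (hp : 0 < p) (hq : 1 < q) :
    ∃ C : ℝ≥0, ∀ f : (Fin n → ℝ) → 𝕜, LocallyIntegrable f →
      squareMorreyNorm p q f ≤ C * morreyNorm p q f := by
  obtain ⟨K, hK⟩ := exists_square_estimates 𝕜 n hq
  have hr0 := scaleRatio_pos (n := n) p
  have hr1 := scaleRatio_lt_one hn hp
  have hq0 : 0 < q := by linarith
  set r := ENNReal.ofReal (scaleRatio n p) with hr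
  have hr1' : r ^ 2 < 1 := by
    rw [hr, ← ENNReal.ofReal_pow hr0.le, ENNReal.ofReal_lt_one]
    exact pow_lt_one₀ hr0.le hr1 two_ne_zero
  -- The sum of r^(2l) over l ≥ 1; the low generations start at k - 1.
  set H : ℝ≥0 := ((1 - r ^ 2)⁻¹ * r ^ 2).toNNReal with hH
  have hHr : (H : ℝ≥0∞) = (1 - r ^ 2)⁻¹ * r ^ 2 := by
    refine ENNReal.coe_toNNReal (ENNReal.mul_ne_top ?_ hr1'.ne_top)
    exact ENNReal.inv_ne_top.2 (tsub_pos_of_lt hr1').ne'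
  set D : ℝ≥0 := 2 ^ (q / 2) * (K + H ^ (q / 2)) with hD
  refine ⟨Fintype.card (HaarIndex n) * D ^ (1 / q), fun f hf => ?_⟩
  have key : ∀ ε : HaarIndex n, morreyNorm p q (squareFunction f ε.1)
      ≤ (D ^ (1 / q) : ℝ≥0) * morreyNorm p q f := by
    intro ε
    refine morreyNorm_le_of_forall hq0 fun k m => ?_
    set B := ENNReal.ofReal (morreyScale n p k) * morreyNorm p q f with hB
    have hpt : ∀ x, ‖squareFunction f ε.1 x‖ₑ ^ q
        ≤ 2 ^ (q / 2) * (squareTail f k x ^ (q / 2) + H ^ (q / 2) * B ^ q) := by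
      intro x
      rw [enorm_eq_self, squareFunction_rpow, tsum_int_eq_add _ k]
      have h1 : ∑' l : ℕ, ‖haarBlock f ε.1 (k + l) x‖ₑ ^ 2 ≤ squareTail f k x := by
        refine ENNReal.tsum_le_tsum fun l => ?_
        exact Finset.single_le_sum (f := fun ε : HaarIndex n => ‖haarBlock f ε.1 (k + l) x‖ₑ ^ 2)
          (fun _ _ => zero_le) (Finset.mem_univ ε)
      have h2 : ∑' l : ℕ, ‖haarBlock f ε.1 (k - (l + 1 : ℕ)) x‖ₑ ^ 2 ≤ H * B ^ 2 := by
        refine (tsum_low_sq_le ε.1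
          (enorm_haarBlock_le_morreyNorm p hq.le hf.aestronglyMeasurable ε.1) k x).trans_eq ?_
        rw [hHr]; ring
      calc _ ≤ (squareTail f k x + H * B ^ 2) ^ (q / 2) := by gcongr
        _ ≤ _ := ennreal_add_rpow_le (by linarith) _ _
        _ = _ := by
          rw [ENNReal.mul_rpow_of_nonneg _ _ (by linarith : 0 ≤ q / 2), ← ENNReal.rpow_two,
            ← ENNReal.rpow_mul, mul_div_cancel₀ _ (two_ne_zero (α := ℝ))]
    calc _ ≤ ∫⁻ x in dyadicCube k m,
          2 ^ (q / 2) * (squareTail f k x ^ (q / 2) + H ^ (q / 2) * B ^ q) := lintegral_mono hpt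
      _ = 2 ^ (q / 2) * ((∫⁻ x in dyadicCube k m, squareTail f k x ^ (q / 2))
          + H ^ (q / 2) * B ^ q * ENNReal.ofReal (cubeVolume n k)) := by
          rw [lintegral_const_mul' _ _ (by simp), lintegral_add_right _ measurable_const,
            setLIntegral_const, volume_dyadicCube]
      _ ≤ 2 ^ (q / 2) * (K * (ENNReal.ofReal (cubeVolume n k) * B ^ q)
          + H ^ (q / 2) * B ^ q * ENNReal.ofReal (cubeVolume n k)) := by
          gcongr
          refine ((hK f hf k m).2).trans ?_
          gcongr
          exact lintegral_rpow_le_morreyNorm p hq0 f k m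
      _ = _ := by
          rw [hD]
          push_cast
          rw [ENNReal.coe_rpow_of_nonneg _ (by linarith), ENNReal.coe_rpow_of_nonneg _ (by linarith)]
          push_cast
          ring
  calc squareMorreyNorm p q f
      ≤ ∑ _ε : HaarIndex n, (D ^ (1 / q) : ℝ≥0) * morreyNorm p q f :=
        Finset.sum_le_sum fun ε _ => key ε
    _ = _ := by
        rw [Finset.sum_const, Finset.card_univ, nsmul_eq_mul]
        push_cast
        ring

theorem tendsto_dyadicAverage_of_morreyNorm_lt_top (hn : 0 < n) (hp : 0 < p) (hq : 1 ≤ q)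
    {f : (Fin n → ℝ) → 𝕜} (hf : AEStronglyMeasurable f) (hM : morreyNorm p q f ≠ ∞)
    (x : Fin n → ℝ) : Tendsto (fun l : ℕ => dyadicAverage f (-l) x) atTop (𝓝 0) := by
  have h1 : ∀ l : ℕ, ‖dyadicAverage f (-l) x‖
      ≤ morreyScale n p 0 * scaleRatio n p ^ l * (morreyNorm p q f).toReal := by
    intro l
    have h := ENNReal.toReal_mono (ENNReal.mul_ne_top ENNReal.ofReal_ne_top hM)
      (enorm_dyadicAverage_mul_le p hq hf (fun _ => rfl) (-l) x)
    rw [toReal_enorm, ENNReal.toReal_mul, ENNReal.toReal_ofReal (morreyScale_pos p _).le] at h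
    rwa [← morreyScale_sub, zero_sub]
  refine squeeze_zero_norm h1 ?_
  simpa using ((tendsto_pow_atTop_nhds_zero_of_lt_one (scaleRatio_pos p).le
    (scaleRatio_lt_one hn hp)).const_mul (morreyScale n p 0)).mul_const (morreyNorm p q f).toReal

end MorreyEstimates

/-! ### Convergence of the Haar expansion in local L^q. -/

section Convergence

/-- Dominated convergence: the full tail from generation 0 is an integrable majorant after raising
to q/2, hence finite almost everywhere, and there the remainders tend to 0. -/
theorem tendsto_lintegral_squareTail (hq : 1 ≤ q) {f : (Fin n → ℝ) → 𝕜}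
    (hR : squareMorreyNorm p q f ≠ ∞) (m : Fin n → ℤ) :
    Tendsto (fun M : ℕ => ∫⁻ x in dyadicCube 0 m, squareTail f (M + 1) x ^ (q / 2)) atTop
      (𝓝 0) := by
  obtain ⟨D, hD⟩ := exists_lintegral_squareTail_le (𝕜 := 𝕜) n p hq
  have hq2 : 0 < q / 2 := by linarith
  have hfin : ∫⁻ x in dyadicCube 0 m, squareTail f 0 x ^ (q / 2) ≠ ∞ := by
    refine ((hD f 0 m).trans_lt ?_).ne
    exact ENNReal.mul_lt_top ENNReal.coe_lt_top (ENNReal.mul_lt_top ENNReal.ofReal_lt_top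
      (ENNReal.rpow_lt_top_of_nonneg (by linarith) (ENNReal.mul_ne_top ENNReal.ofReal_ne_top hR)))
  have htail : ∀ (M : ℕ) x, squareTail f (M + 1) x
      = ∑' l : ℕ, squareLayer f (0 + ((l + (M + 1) : ℕ) : ℤ)) x := by
    intro M x
    simp only [squareTail]
    congr 1
    funext l
    congr 1
    push_cast
    ring
  rw [← lintegral_zero (μ := volume.restrict (dyadicCube 0 m))]
  refine tendsto_lintegral_of_dominated_convergence (fun x => squareTail f 0 x ^ (q / 2))
    (fun M => (measurable_squareTail f _).pow_const _) (fun M => Eventually.of_forall fun x => ?_)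
    hfin ?_
  · simp only
    gcongr
    rw [htail]
    exact ENNReal.tsum_comp_le_tsum_of_injective (add_left_injective (M + 1))
      fun l : ℕ => squareLayer f (0 + (l : ℤ)) x
  · filter_upwards [ae_lt_top ((measurable_squareTail f 0).pow_const _) hfin] with x hx
    have hx' : squareTail f 0 x ≠ ∞ := by
      intro h
      rw [h, ENNReal.top_rpow_of_pos hq2] at hx
      exact lt_irrefl _ hx
    have h1 := (ENNReal.tendsto_sum_nat_add (fun l : ℕ => squareLayer f (0 + (l : ℤ)) x)
      hx').comp (tendsto_add_atTop_nat 1)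
    have h2 := (ENNReal.continuous_rpow_const (y := q / 2)).tendsto 0 |>.comp h1
    rw [ENNReal.zero_rpow_of_pos hq2] at h2
    refine h2.congr fun M => ?_
    simp only [Function.comp, htail]

theorem tendstoLqLoc_haarPartialSum (hn : 0 < n) (hp : 0 < p) (hq : 1 < q)
    {f c : (Fin n → ℝ) → 𝕜} (hf : LocallyIntegrable f) (hR : squareMorreyNorm p q f ≠ ∞)
    (hc : ∀ k, Function.FactorsThrough c (cubeIndex k))
    (hcb : ∀ k x, ‖dyadicAverage f k x - c x‖ ≤ (Fintype.card (HaarIndex n) : ℕ) /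
        (1 - scaleRatio n p) * (morreyScale n p k * (squareMorreyNorm p q f).toReal))
    (hmem : MemLqLoc q (f - c)) : TendstoLqLoc q (haarPartialSum f) (f - c) := by
  have hq0 : 0 < q := by linarith
  refine ⟨fun M => ?_, hmem, fun K hK => ?_⟩
  · refine memLqLoc_of_factorsThrough hq0 (k := M + 1) fun x y h => ?_
    rw [haarPartialSum_eq hf, haarPartialSum_eq hf, dyadicAverage_factorsThrough f _ h,
      dyadicAverage_factorsThrough f _ (cubeIndex_factorsThrough (by omega) h)]
  obtain ⟨T, hT⟩ := exists_cover_dyadicCube hK 0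
  obtain ⟨A, hA⟩ := exists_square_estimates 𝕜 n hq
  have hr1 := scaleRatio_lt_one hn hp
  set G : ℝ≥0 := ⟨((Fintype.card (HaarIndex n) : ℕ) : ℝ) / (1 - scaleRatio n p),
    div_nonneg (Nat.cast_nonneg _) (by linarith)⟩ with hG
  have hcube : ∀ (M : ℕ) (m : Fin n → ℤ),
      ∫⁻ x in dyadicCube 0 m, ‖(haarPartialSum f M - (f - c)) x‖ₑ ^ q
      ≤ 2 ^ q * (A * ∫⁻ x in dyadicCube 0 m, squareTail f (M + 1) x ^ (q / 2)) +
        2 ^ q * (G ^ q * (ENNReal.ofReal (cubeVolume n 0) *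
          (ENNReal.ofReal (morreyScale n p (-M)) * squareMorreyNorm p q f) ^ q)) := by
    intro M m
    have h1 : ∀ x, ‖(haarPartialSum f M - (f - c)) x‖ₑ ^ q
        ≤ 2 ^ q * (‖f x - dyadicAverage f (M + 1) x‖ₑ ^ q
          + ‖dyadicAverage f (-M) x - c x‖ₑ ^ q) := by
      intro x
      refine le_trans (ENNReal.rpow_le_rpow ?_ hq0.le) (ennreal_add_rpow_le hq0.le _ _)
      -- By telescoping, the error consists of a fine part f - E_{M+1} f, governed by the square
      -- tail, and a coarse part E_{-M} f - c, governed by the scale.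
      have e : (haarPartialSum f M - (f - c)) x
          = -((f x - dyadicAverage f (M + 1) x) + (dyadicAverage f (-M) x - c x)) := by
        simp only [Pi.sub_apply, haarPartialSum_eq hf]; ring
      rw [e, enorm_neg]
      exact enorm_add_le _ _
    refine (lintegral_mono h1).trans ?_
    have hm : Measurable fun x => ‖dyadicAverage f (-M) x - c x‖ₑ ^ q :=
      ((measurable_dyadicAverage f _).sub (measurable_of_factorsThrough (hc 0))).enorm.pow_const q
    rw [lintegral_const_mul' _ _ (by simp), lintegral_add_right _ hm, ← mul_add]
    gcongr
    · exact (hA f hf 0 m).1 (M + 1) (by omega)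
    · exact lintegral_dyadicAverage_sub_rpow_le hq0 hR (fun x => hcb _ x) 0 m
  have hscale : Tendsto (fun M : ℕ => (ENNReal.ofReal (morreyScale n p (-M)) *
      squareMorreyNorm p q f) ^ q) atTop (𝓝 0) := by
    have h1 : Tendsto (fun M : ℕ => ENNReal.ofReal (morreyScale n p (-M))) atTop (𝓝 0) := by
      rw [← ENNReal.ofReal_zero]
      refine ENNReal.tendsto_ofReal ?_
      have e : ∀ M : ℕ, morreyScale n p (-M) = morreyScale n p 0 * scaleRatio n p ^ M :=
        fun M => by rw [← morreyScale_sub, zero_sub]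
      simp only [e]
      simpa using (tendsto_pow_atTop_nhds_zero_of_lt_one (scaleRatio_pos p).le hr1).const_mul
        (morreyScale n p 0)
    have h2 := ENNReal.Tendsto.mul_const h1 (Or.inr hR)
    rw [zero_mul] at h2
    have h3 := ((ENNReal.continuous_rpow_const (y := q)).tendsto 0).comp h2
    rwa [ENNReal.zero_rpow_of_pos hq0] at h3
  have hbound : Tendsto (fun M : ℕ => ∑ m ∈ T,
      (2 ^ q * (A * ∫⁻ x in dyadicCube 0 m, squareTail f (M + 1) x ^ (q / 2)) +
        2 ^ q * (G ^ q * (ENNReal.ofReal (cubeVolume n 0) *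
          (ENNReal.ofReal (morreyScale n p (-M)) * squareMorreyNorm p q f) ^ q)))) atTop
      (𝓝 0) := by
    suffices h : ∀ m ∈ T, Tendsto (fun M : ℕ =>
        2 ^ q * (A * ∫⁻ x in dyadicCube 0 m, squareTail f (M + 1) x ^ (q / 2)) +
          2 ^ q * (G ^ q * (ENNReal.ofReal (cubeVolume n 0) *
            (ENNReal.ofReal (morreyScale n p (-M)) * squareMorreyNorm p q f) ^ q))) atTop
        (𝓝 0) by
      have h0 := tendsto_finsetSum T h
      rwa [Finset.sum_const_zero] at h0
    intro m _
    have h2q : (2 : ℝ≥0∞) ^ q ≠ ∞ := by simp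
    have h1 := ENNReal.Tendsto.const_mul (a := 2 ^ q) (ENNReal.Tendsto.const_mul (a := (A : ℝ≥0∞))
      (tendsto_lintegral_squareTail hq.le hR m) (Or.inr ENNReal.coe_ne_top)) (Or.inr h2q)
    have h2 := ENNReal.Tendsto.const_mul (a := 2 ^ q) (ENNReal.Tendsto.const_mul
      (a := (G : ℝ≥0∞) ^ q) (ENNReal.Tendsto.const_mul (a := ENNReal.ofReal (cubeVolume n 0)) hscale
        (Or.inr ENNReal.ofReal_ne_top))
      (Or.inr (ENNReal.rpow_ne_top_of_nonneg hq0.le ENNReal.coe_ne_top))) (Or.inr h2q)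
    simpa using h1.add h2
  have hint : Tendsto (fun M : ℕ => ∫⁻ x in K, ‖(haarPartialSum f M - (f - c)) x‖ₑ ^ q) atTop
      (𝓝 0) :=
    tendsto_of_tendsto_of_tendsto_of_le_of_le tendsto_const_nhds hbound (fun _ => zero_le)
      fun M => (lintegral_le_sum_of_cover hT _).trans (Finset.sum_le_sum fun m _ => hcube M m)
  have h3 := ((ENNReal.continuous_rpow_const (y := 1 / q)).tendsto 0).comp hint
  rw [ENNReal.zero_rpow_of_pos (by positivity)] at h3
  refine h3.congr fun M => ?_
  rw [eLpNorm_eq_lintegral_rpow_enorm_toReal (by simpa using hq0) ENNReal.ofReal_ne_top,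
    ENNReal.toReal_ofReal hq0.le]
  rfl

end Convergence

end HaarMorrey

end

/-! ### The main theorem. -/

theorem theorem1 {𝕜 : Type*} [RCLike 𝕜] (n : ℕ) (hn : 0 < n) (p q : ℝ) (hq : 1 < q) (hqp : q ≤ p) :
    ∃ C : ℝ≥0,
      (∀ f : (Fin n → ℝ) → 𝕜, HaarMorrey.MemMorrey p q f →
        HaarMorrey.morreyNorm p q f ≤ C * HaarMorrey.squareMorreyNorm p q f ∧
        HaarMorrey.squareMorreyNorm p q f ≤ C * HaarMorrey.morreyNorm p q f) ∧
      (∀ f : (Fin n → ℝ) → 𝕜, LocallyIntegrable f volume →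
        HaarMorrey.squareMorreyNorm p q f < ∞ →
        ∃ g : (Fin n → ℝ) → 𝕜,
          HaarMorrey.TendstoLqLoc q (HaarMorrey.haarPartialSum f) g ∧
          HaarMorrey.MemMorrey p q g ∧
          HaarMorrey.morreyNorm p q g ≤ C * HaarMorrey.squareMorreyNorm p q f ∧
          HaarMorrey.squareMorreyNorm p q f ≤ C * HaarMorrey.morreyNorm p q g) := by
  have hp : 0 < p := by linarith
  have hq0 : 0 < q := by linarith
  obtain ⟨C₁, h₁⟩ := HaarMorrey.exists_morreyNorm_sub_le 𝕜 hn hp hq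
  obtain ⟨C₂, h₂⟩ := HaarMorrey.exists_squareMorreyNorm_le 𝕜 hn hp hq
  have hC₁ : (C₁ : ℝ≥0∞) ≤ ((C₁ + C₂ + 1 : ℝ≥0) : ℝ≥0∞) := by
    rw [add_assoc]
    exact ENNReal.coe_le_coe.2 le_self_add
  have hC₂ : (C₂ : ℝ≥0∞) ≤ ((C₁ + C₂ + 1 : ℝ≥0) : ℝ≥0∞) :=
    ENNReal.coe_le_coe.2 (le_add_self.trans le_self_add)
  -- The summand 1 makes the constant nonzero, so that its product with S(f) = ∞ is ∞ in the first
  -- bound.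
  refine ⟨C₁ + C₂ + 1, fun f hf => ?_, fun f hf hR => ?_⟩
  · have hloc := hf.1.locallyIntegrable hq.le
    refine ⟨?_, (h₂ f hloc).trans (by gcongr)⟩
    by_cases hR : HaarMorrey.squareMorreyNorm p q f = ∞
    · rw [hR, ENNReal.mul_top (by positivity)]
      exact le_top
    obtain ⟨c, hc, hcf, hcb⟩ := HaarMorrey.exists_limit_dyadicAverage hn hp hq0 hloc hR
    -- The Morrey bound on f forces its averages over growing cubes to 0, so there is nothing to
    -- subtract.
    have hc0 : c = 0 := by
      funext x
      exact tendsto_nhds_unique (hc x) (HaarMorrey.tendsto_dyadicAverage_of_morreyNorm_lt_top hn hp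
        hq.le hloc.aestronglyMeasurable hf.2.ne x)
    have h := h₁ f c hloc hR hcf hcb
    rw [hc0, sub_zero] at h
    exact h.trans (by gcongr)
  · obtain ⟨c, -, hcf, hcb⟩ := HaarMorrey.exists_limit_dyadicAverage hn hp hq0 hf hR.ne
    have h := h₁ f c hf hR.ne hcf hcb
    have hlt : HaarMorrey.morreyNorm p q (f - c) < ∞ :=
      h.trans_lt (ENNReal.mul_lt_top ENNReal.coe_lt_top hR)
    have hmem : HaarMorrey.MemLqLoc q (f - c) := by
      refine HaarMorrey.memLqLoc_of_lintegral_lt_top hq0 (hf.aestronglyMeasurable.sub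
        (HaarMorrey.measurable_of_factorsThrough (hcf 0)).aestronglyMeasurable) 0 fun m => ?_
      refine (HaarMorrey.lintegral_rpow_le_morreyNorm p hq0 (f - c) 0 m).trans_lt ?_
      exact ENNReal.mul_lt_top ENNReal.ofReal_lt_top (ENNReal.rpow_lt_top_of_nonneg hq0.le
        (ENNReal.mul_ne_top ENNReal.ofReal_ne_top hlt.ne))
    refine ⟨f - c, HaarMorrey.tendstoLqLoc_haarPartialSum hn hp hq hf hR.ne hcf hcb hmem,
      ⟨hmem, hlt⟩, h.trans (by gcongr), ?_⟩
    -- The reverse bound is applied to g = f - c, whose square functions are those of f.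
    have h3 := h₂ (f - c) (hmem.locallyIntegrable hq.le)
    rw [HaarMorrey.squareMorreyNorm_sub_eq hf hcf] at h3
    exact h3.trans (by gcongr)
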